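/- **Setting.** Let $A=A_c\cup A_i\cup A_r$ be a finite alphabet partitioned into calls, internals and returns. A *stair parity DVPA* over $A$ consists of a finite state set $Q$ with initial state $q_0$, a finite stack alphabet $\Gamma$ (with a bottom symbol $\bot\notin\Gamma$), total transition functions $\delta_c:Q\times A_c\to Q\times\Gamma$ (push), $\delta_r:Q\times\Gamma\times A_r\to Q$ (pop) and $\delta_i:Q\times A_i\to Q$ (stack unchanged), and a priority function $\Omega:Q\to\mathbb N$. A return has no transition on the empty stack $\bot$. The run on an infinite word starts in $(q_0,\bot)$ and need not exist. A configuration $(q,\sigma)$ of an infinite run is a *step* if $|\sigma|\le|\sigma'|$ for every later configuration $(q',\sigma')$ of the run. An infinite word is accepted if there is a run on it and the highest priority that occurs infinitely often on steps of this run is even. The number of priorities of the automaton is $|\Omega(Q)|$. The *stair parity index problem* is: given a stair parity DVPA $\mathcal A$, compute the smallest number of priorities of a stair parity DVPA, over the same partitioned alphabet and with arbitrary finite state set and stack alphabet, that accepts exactly the same infinite words as $\mathcal A$. **Theorem.** The stair parity index problem for stair parity DVPAs can be solved in polynomial time. That is, there are a single algorithm and a polynomial $p$ such that on every stair parity DVPA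 $\mathcal A$ (with alphabets, states and stack symbols numbered from $0$; given by the sizes of these sets, the initial state, the list of priorities and the tables of the transition functions, all numbers in binary) the algorithm outputs the smallest number of priorities and halts within $p(|\mathcal A|)$ steps, where $|\mathcal A|$ is the length of this description. Steps are counted on a random access machine over $\mathbb N$ with unit-cost addition, truncated subtraction, halving, indirect loads and stores, and tests for zero (no multiplication), which is polynomially equivalent to Turing machines. -/

import Mathlib

/-! ### Visibly pushdown automata with stair parity condition -/

/-- Letters of an alphabet that is partitioned into calls, internals and returns. -/
inductive VLetter (Ac Ai Ar : Type) : Type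
  | call (c : Ac) : VLetter Ac Ai Ar
  | intern (i : Ai) : VLetter Ac Ai Ar
  | ret (r : Ar) : VLetter Ac Ai Ar

/-- A deterministic visibly pushdown machine with states `Q` and stack alphabet `Γ` over the
partitioned alphabet with calls `Ac`, internals `Ai` and returns `Ar`, together with a priority
function. The bottom symbol is not an element of `Γ`; there is no transition for a return on the
empty stack. -/
structure ParityDVPA (Ac Ai Ar Q Γ : Type) : Type where
  start : Q
  δc : Q → Ac → Q × Γ
  δi : Q → Ai → Q
  δr : Q → Γ → Ar → Q
  prio : Q → ℕ

namespace ParityDVPA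

variable {Ac Ai Ar Q Γ : Type}

/-- `A.Move C a D`: reading `a` in the configuration `C` leads to the configuration `D`.
A configuration consists of a state and the stack content above the bottom symbol, top first. -/
inductive Move (A : ParityDVPA Ac Ai Ar Q Γ) :
    Q × List Γ → VLetter Ac Ai Ar → Q × List Γ → Prop
  | call (q : Q) (σ : List Γ) (c : Ac) :
      Move A (q, σ) (.call c) ((A.δc q c).1, (A.δc q c).2 :: σ)
  | intern (q : Q) (σ : List Γ) (i : Ai) :
      Move A (q, σ) (.intern i) (A.δi q i, σ)
  | ret (q : Q) (Z : Γ) (σ : List Γ) (r : Ar) :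
      Move A (q, Z :: σ) (.ret r) (A.δr q Z r, σ)

/-- `ρ` is the run of `A` on the infinite word `w`. -/
def IsRun (A : ParityDVPA Ac Ai Ar Q Γ) (w : ℕ → VLetter Ac Ai Ar) (ρ : ℕ → Q × List Γ) : Prop :=
  ρ 0 = (A.start, []) ∧ ∀ n, A.Move (ρ n) (w n) (ρ (n + 1))

/-- Position `n` of the sequence `ρ` of configurations is a step: no later configuration has a
smaller stack height. -/
def IsStep (ρ : ℕ → Q × List Γ) (n : ℕ) : Prop :=
  ∀ m, n ≤ m → (ρ n).2.length ≤ (ρ m).2.length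

/-- The set of priorities that occur infinitely often on steps of `ρ`. -/
def infStepPrio (A : ParityDVPA Ac Ai Ar Q Γ) (ρ : ℕ → Q × List Γ) : Set ℕ :=
  {k | {n | IsStep ρ n ∧ A.prio (ρ n).1 = k}.Infinite}

/-- The language of infinite words accepted by `A` as a stair parity automaton: the highest
priority that occurs infinitely often on a step of the run is even. -/
def stairLanguage (A : ParityDVPA Ac Ai Ar Q Γ) : Set (ℕ → VLetter Ac Ai Ar) :=
  {w | ∃ ρ, A.IsRun w ρ ∧ ∃ k, IsGreatest (A.infStepPrio ρ) k ∧ Even k}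

/-- The number of priorities that `A` uses. -/
noncomputable def numPrio (A : ParityDVPA Ac Ai Ar Q Γ) : ℕ := (Set.range A.prio).ncard

/-- `k` is the smallest number of priorities that a stair parity DVPA over the same partitioned
alphabet needs for accepting the stair language of `A`. -/
def IsStairParityIndex (A : ParityDVPA Ac Ai Ar Q Γ) (k : ℕ) : Prop :=
  IsLeast {n | ∃ (Q' Γ' : Type) (_ : Finite Q') (_ : Finite Γ')
    (B : ParityDVPA Ac Ai Ar Q' Γ'), B.stairLanguage = A.stairLanguage ∧ B.numPrio = n} k

end ParityDVPA

/-! ### Random access machines with uniform cost -/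

namespace RAM

/-- Structured programs of a random access machine. It has registers `0, 1, 2, …` and an
indirectly addressed memory; all of them hold natural numbers. There is no multiplication. -/
inductive Prog : Type
  /-- register `d` gets the value `v` -/
  | const (d v : ℕ) : Prog
  /-- register `d` gets the sum of registers `a` and `b` -/
  | add (d a b : ℕ) : Prog
  /-- register `d` gets the truncated difference of registers `a` and `b` -/
  | sub (d a b : ℕ) : Prog
  /-- register `d` gets half of register `a`, rounded down -/
  | half (d a : ℕ) : Prog
  /-- register `d` gets the memory cell whose address is in register `a` -/
  | load (d a : ℕ) : Prog
  /-- the memory cell whose address is in register `a` gets the value of register `b` -/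
  | store (a b : ℕ) : Prog
  | seq (P₁ P₂ : Prog) : Prog
  /-- `P₁` if register `a` is nonzero, `P₂` otherwise -/
  | cond (a : ℕ) (P₁ P₂ : Prog) : Prog
  /-- repeat `P` as long as register `a` is nonzero -/
  | loop (a : ℕ) (P : Prog) : Prog

structure State : Type where
  reg : ℕ → ℕ
  mem : ℕ → ℕ

/-- Assignment to a register. -/
def State.setReg (s : State) (d v : ℕ) : State := { s with reg := Function.update s.reg d v }

/-- Assignment to a memory cell. -/
def State.setMem (s : State) (d v : ℕ) : State := { s with mem := Function.update s.mem d v }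

/-- `Exec P s t s'`: started in the state `s`, the program `P` halts after exactly `t` steps in the
state `s'`. Every assignment and every test of a register counts as one step. As one step
lengthens the longest number in the machine by at most one bit (up to the constants of the
program), polynomial time on this machine and on Turing machines is the same. -/
inductive Exec : Prog → State → ℕ → State → Prop
  | const (s : State) (d v : ℕ) : Exec (.const d v) s 1 (s.setReg d v)
  | add (s : State) (d a b : ℕ) : Exec (.add d a b) s 1 (s.setReg d (s.reg a + s.reg b))
  | sub (s : State) (d a b : ℕ) : Exec (.sub d a b) s 1 (s.setReg d (s.reg a - s.reg b))
  | half (s : State) (d a : ℕ) : Exec (.half d a) s 1 (s.setReg d (s.reg a / 2))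
  | load (s : State) (d a : ℕ) : Exec (.load d a) s 1 (s.setReg d (s.mem (s.reg a)))
  | store (s : State) (a b : ℕ) : Exec (.store a b) s 1 (s.setMem (s.reg a) (s.reg b))
  | seq {P₁ P₂ : Prog} {s s₁ s₂ : State} {t₁ t₂ : ℕ} :
      Exec P₁ s t₁ s₁ → Exec P₂ s₁ t₂ s₂ → Exec (.seq P₁ P₂) s (t₁ + t₂) s₂
  | cond_true {a : ℕ} {P₁ P₂ : Prog} {s s' : State} {t : ℕ} :
      s.reg a ≠ 0 → Exec P₁ s t s' → Exec (.cond a P₁ P₂) s (t + 1) s'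
  | cond_false {a : ℕ} {P₁ P₂ : Prog} {s s' : State} {t : ℕ} :
      s.reg a = 0 → Exec P₂ s t s' → Exec (.cond a P₁ P₂) s (t + 1) s'
  | loop_done {a : ℕ} {P : Prog} {s : State} :
      s.reg a = 0 → Exec (.loop a P) s 1 s
  | loop_next {a : ℕ} {P : Prog} {s s₁ s₂ : State} {t₁ t₂ : ℕ} :
      s.reg a ≠ 0 → Exec P s t₁ s₁ → Exec (.loop a P) s₁ t₂ s₂ →
      Exec (.loop a P) s (t₁ + t₂ + 1) s₂

/-- The initial state on input `l`: the entries of `l` are in the memory cells `0, 1, …`, all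
other cells and all registers are zero. -/
def inputState (l : List ℕ) : State where
  reg := fun _ => 0
  mem := fun i => l.getD i 0

/-- On input `l` the program halts within `T` steps, with output `k` in register `0`. -/
def OutputsWithin (P : Prog) (l : List ℕ) (T k : ℕ) : Prop :=
  ∃ t s, t ≤ T ∧ Exec P (inputState l) t s ∧ s.reg 0 = k

/-- The number of bits of the input `l`, where every entry counts with its binary length and
one separator. -/
def inputSize (l : List ℕ) : ℕ := (l.map fun x => Nat.size x + 1).sum

end RAM

/-! ### Automata as inputs of a machine -/

/-- The values of a function of two arguments, row by row. -/
def tableOf {m n : ℕ} (f : Fin m → Fin n → ℕ) : List ℕ :=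
  List.ofFn fun k : Fin (m * n) => f (finProdFinEquiv.symm k).1 (finProdFinEquiv.symm k).2

/-- The description of a stair parity DVPA with alphabets, states and stack symbols numbered
from `0`: the sizes of these five sets, the initial state, the priorities (which are
written in binary when the size of the input is measured) and the tables of the transition
functions. -/
def ParityDVPA.encode {nc ni nr nq ng : ℕ}
    (A : ParityDVPA (Fin nc) (Fin ni) (Fin nr) (Fin nq) (Fin ng)) : List ℕ :=
  [nc, ni, nr, nq, ng, (A.start : ℕ)]
    ++ List.ofFn A.prio
    ++ tableOf (fun q i => (A.δi q i : ℕ))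
    ++ tableOf (fun q c => ((A.δc q c).1 : ℕ))
    ++ tableOf (fun q c => ((A.δc q c).2 : ℕ))
    ++ tableOf (fun (qZ : Fin (nq * ng)) r =>
        (A.δr (finProdFinEquiv.symm qZ).1 (finProdFinEquiv.symm qZ).2 r : ℕ))

/-! ### Steps of runs -/

namespace ParityDVPA

variable {Ac Ai Ar Q Γ : Type}

/-! The stack can be eliminated from the problem. Between two consecutive steps a run reads an
internal letter, a call with its matching return and a well-matched word between them, or a call
that is never matched. So the states at the steps form an infinite path in the finite graph `Edge`
(`IsRun.exists_steps`), and every infinite path from the initial state arises in this way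
(`exists_run_of_edges`). Stair parity acceptance thereby becomes an ordinary parity condition on a
finite graph, whose index is governed by alternating chains of nested loops, as for parity automata
on infinite words.

`Rank` measures such chains relative to the parity `b` of the smallest colour in use. For the upper
bound, a state gets the colour `b + k - 1` where `k` is its largest rank. This keeps the language,
since among the states that recur on a path one of highest original priority also has the largest
rank and its colour has the right parity (`isDominant_rankPrio`, `exists_numPrio_le`).

For the lower bound, an equivalent `B` runs in parallel with `A`. Both have the same stack heights,
hence the same steps. A loop of `A` at `v` forces a priority of `B` with the parity of `v` that
recurs and is maximal there (`exists_loop_value`). Along a chain these priorities increase strictly,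
because each region of the product contains one for the preceding loop and neighbouring parities
differ (`Rank.exists_prio`). The index is the minimum over `b` of the longest chain
(`isStairParityIndex_of_isGreatest`).

Summaries, edges, reachability, connections and ranks are all least fixed points of Horn rules over
tuples of boundedly many small numbers. There are at most `(nq + 10) ^ 4` codes of facts, so that
many passes and one more saturate the set (`Passes.closed`), and each pass takes polynomial time
(`applies_passProg`). Correctness of the program is the agreement of the rules with the inductive
definitions (`closed_factRules_iff`, `Loaded.saturated`). -/

/-- Summaries of well-matched words: `A.Summary true x y` holds if some well-matched word leads
from `x` to `y`, and `A.Summary false x y` if this word can be chosen as an internal letter or as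
a call, a well-matched word and the matching return. -/
inductive Summary (A : ParityDVPA Ac Ai Ar Q Γ) : Bool → Q → Q → Prop
  | refl (x : Q) : Summary A true x x
  | snoc {x y z : Q} : Summary A true x y → Summary A false y z → Summary A true x z
  | intern (x : Q) (i : Ai) : Summary A false x (A.δi x i)
  | nest (x : Q) (c : Ac) (z : Q) (r : Ar) :
      Summary A true (A.δc x c).1 z → Summary A false x (A.δr z (A.δc x c).2 r)

/-- The possible changes of the state between two consecutive steps of a run. -/
def Edge (A : ParityDVPA Ac Ai Ar Q Γ) (x y : Q) : Prop :=
  A.Summary false x y ∨ ∃ c, (A.δc x c).1 = y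

theorem Summary.trans {A : ParityDVPA Ac Ai Ar Q Γ} {x y z : Q} (h : A.Summary true x y)
    {b : Bool} (h' : A.Summary b y z) : A.Summary true x z := by
  induction h' with
  | refl => exact h
  | snoc _ h₂ ih _ => exact (ih h).snoc h₂
  | intern x i => exact h.snoc (.intern x i)
  | nest x c z r h₁ _ => exact h.snoc (.nest x c z r h₁)

/-- `A.Next C D`: some letter leads from the configuration `C` to the configuration `D`. -/
def Next (A : ParityDVPA Ac Ai Ar Q Γ) (C D : Q × List Γ) : Prop := ∃ a, A.Move C a D

/-! ### Decomposition of a run at its steps. -/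

section Decompose

variable {A : ParityDVPA Ac Ai Ar Q Γ} {ρ : ℕ → Q × List Γ}

/-- The first letter is internal, or a call whose symbol is popped exactly at the end; the part in
between stays above that symbol. The hypothesis `HW` on shorter segments makes the lemma usable
inside the induction of `summary_of_run` as well as afterwards. -/
theorem first_return (hρ : ∀ n, A.Next (ρ n) (ρ (n + 1))) (n : ℕ)
    (HW : ∀ m < n, ∀ i x σ, ρ i = (x, σ) → (ρ (i + m)).2.length = σ.length →
      (∀ k ≤ m, σ.length ≤ (ρ (i + k)).2.length) →
      ∃ y, ρ (i + m) = (y, σ) ∧ A.Summary true x y)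
    (i : ℕ) (x : Q) (σ : List Γ) (hi : ρ i = (x, σ)) (hn : 0 < n)
    (hend : (ρ (i + n)).2.length = σ.length)
    (hbet : ∀ k, 0 < k → k < n → σ.length < (ρ (i + k)).2.length) :
    ∃ y, ρ (i + n) = (y, σ) ∧ A.Summary false x y := by
  obtain ⟨a, ha⟩ := hρ i
  rw [hi] at ha
  have h1 : n = 1 ∨ 1 < n := by omega
  generalize hC : ρ (i + 1) = C at ha
  cases ha with
  | call _ _ c =>
    rcases h1 with rfl | h1
    · rw [hC] at hend; simp at hend
    obtain ⟨m, rfl⟩ : ∃ m, n = m + 2 := ⟨n - 2, by omega⟩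
    obtain ⟨a', ha'⟩ := hρ (i + 1 + m)
    have e : i + 1 + m + 1 = i + (m + 2) := by ring
    rw [e] at ha'
    have hb := hbet (m + 1) (by omega) (by omega)
    rw [show i + (m + 1) = i + 1 + m by ring] at hb
    generalize hD : ρ (i + (m + 2)) = D at ha' hend
    generalize hE : ρ (i + 1 + m) = E at ha' hb
    cases ha' with
    | call => simp at hend hb; omega
    | intern => simp at hend hb; omega
    | ret q Z τ r =>
      simp at hend hb
      obtain ⟨z, hz, hs⟩ := HW m (by omega) (i + 1) _ _ hC (by rw [hE]; simp [hend])
        (fun k hk => by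
          have := hbet (k + 1) (by omega) (by omega)
          rw [show i + (k + 1) = i + 1 + k by ring] at this
          simpa using this)
      rw [hE] at hz
      simp only [Prod.mk.injEq, List.cons.injEq] at hz
      obtain ⟨rfl, rfl, rfl⟩ := hz
      exact ⟨_, rfl, .nest _ _ _ _ hs⟩
  | intern _ _ j =>
    rcases h1 with rfl | h1
    · exact ⟨_, hC, .intern _ _⟩
    · have := hbet 1 one_pos h1
      rw [hC] at this; simp at this
  | ret _ Z τ r =>
    rcases h1 with rfl | h1
    · rw [hC] at hend; simp at hend
    · have := hbet 1 one_pos h1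
      rw [hC] at this; simp at this

/-- Strong induction on the length: cut at the first return to the initial height. The first piece
is a single factor, the rest is shorter. -/
theorem summary_of_run (hρ : ∀ n, A.Next (ρ n) (ρ (n + 1))) (n : ℕ) :
    ∀ i x σ, ρ i = (x, σ) → (ρ (i + n)).2.length = σ.length →
      (∀ k ≤ n, σ.length ≤ (ρ (i + k)).2.length) →
      ∃ y, ρ (i + n) = (y, σ) ∧ A.Summary true x y := by
  induction n using Nat.strong_induction_on with
  | _ n ih =>
    intro i x σ hi hend hge
    rcases Nat.eq_zero_or_pos n with rfl | hn
    · exact ⟨x, hi, .refl x⟩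
    classical
    have hex : ∃ k, 0 < k ∧ k ≤ n ∧ (ρ (i + k)).2.length ≤ σ.length := ⟨n, hn, le_rfl, hend.le⟩
    obtain ⟨hm0, hmn, hml⟩ := Nat.find_spec hex
    have hmin : ∀ k, 0 < k → k < Nat.find hex → σ.length < (ρ (i + k)).2.length := by
      intro k hk hlt
      have := Nat.find_min hex hlt
      by_contra hcon
      exact this ⟨hk, by omega, by omega⟩
    generalize Nat.find hex = m at *
    obtain ⟨y, hy, hs⟩ := first_return hρ m (fun m' hm' => ih m' (by omega)) i x σ hi hm0
      (le_antisymm hml (hge m hmn)) hmin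
    obtain ⟨z, hz, hs'⟩ := ih (n - m) (by omega) (i + m) y σ hy
      (by rw [show i + m + (n - m) = i + n by omega]; exact hend)
      (fun k hk => by rw [add_assoc]; exact hge _ (by omega))
    refine ⟨z, by rw [← hz]; congr 1; omega, ?_⟩
    exact ((Summary.refl x).snoc hs).trans hs'

/-- If the stack comes back to the height of the step, the first such time is the next step.
Otherwise the letter read at the step is a call that is never matched, and the very next
configuration is a step. -/
theorem IsStep.exists_next (hρ : ∀ n, A.Next (ρ n) (ρ (n + 1))) {n : ℕ} (hn : IsStep ρ n) :
    ∃ m, n < m ∧ IsStep ρ m ∧ A.Edge (ρ n).1 (ρ m).1 ∧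
      ∀ k, n < k → k < m → ¬ IsStep ρ k := by
  classical
  by_cases hex : ∃ k, 0 < k ∧ (ρ (n + k)).2.length ≤ (ρ n).2.length
  · obtain ⟨hm0, hml⟩ := Nat.find_spec hex
    have hmin : ∀ k, 0 < k → k < Nat.find hex → (ρ n).2.length < (ρ (n + k)).2.length := by
      intro k hk hlt
      have := Nat.find_min hex hlt
      by_contra hcon
      exact this ⟨hk, by omega⟩
    generalize Nat.find hex = m at *
    obtain ⟨y, hy, hs⟩ := first_return hρ m (fun m' _ => summary_of_run hρ m') n _ _ rfl hm0
      (le_antisymm hml (hn _ (by omega))) hmin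
    refine ⟨n + m, by omega, fun k hk => hml.trans (hn k (by omega)), .inl ?_, ?_⟩
    · rw [hy]; exact hs
    · intro k hk hkm hstep
      have h1 := hstep (n + m) hkm.le
      have h2 := hmin (k - n) (by omega) (by omega)
      rw [show n + (k - n) = k by omega] at h2
      omega
  · push Not at hex
    refine ⟨n + 1, by omega, ?_, ?_, fun k h1 h2 => by omega⟩
    all_goals
      obtain ⟨a, ha⟩ := hρ n
      have h1 := hex 1 one_pos
      generalize hD : ρ (n + 1) = D at ha h1
      generalize hE : ρ n = E at ha h1 hex
      cases ha with
      | call q σ c =>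
        first
        | exact .inr ⟨c, rfl⟩
        | intro k hk
          have := hex (k - n) (by omega)
          rw [show n + (k - n) = k by omega] at this
          rw [hD]; simpa using this
      | intern => simp at h1
      | ret => simp at h1

/-- The steps of a run form an infinite path in the graph of the edges. -/
theorem IsRun.exists_steps {w : ℕ → VLetter Ac Ai Ar} (h : A.IsRun w ρ) :
    ∃ pos : ℕ → ℕ, StrictMono pos ∧ pos 0 = 0 ∧ (∀ n, IsStep ρ n ↔ ∃ i, pos i = n) ∧
      ∀ i, A.Edge (ρ (pos i)).1 (ρ (pos (i + 1))).1 := by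
  have hρ : ∀ n, A.Next (ρ n) (ρ (n + 1)) := fun n => ⟨_, h.2 n⟩
  choose f hf using fun n : {n // IsStep ρ n} => IsStep.exists_next hρ n.2
  have h0 : IsStep ρ 0 := fun m _ => by rw [h.1]; simp
  let seq : ℕ → {n // IsStep ρ n} := fun i => (fun n => ⟨f n, (hf n).2.1⟩)^[i] ⟨0, h0⟩
  have hs : ∀ i, (seq (i + 1)).1 = f (seq i) := fun i => by
    simp only [seq, Function.iterate_succ_apply']
  have hmono : StrictMono fun i => (seq i).1 := strictMono_nat_of_lt_succ fun i => by
    rw [hs]; exact (hf _).1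
  refine ⟨fun i => (seq i).1, hmono, rfl, fun n => ⟨fun hn => ?_, ?_⟩, fun i => ?_⟩
  · by_contra hne
    push Not at hne
    -- A step missed by the sequence would bound it: no step lies strictly between consecutive
    -- members. A strictly increasing sequence has no bound.
    have : ∀ i, (seq i).1 < n := by
      intro i
      induction i with
      | zero => exact lt_of_le_of_ne (Nat.zero_le n) (hne 0)
      | succ i ih =>
        refine lt_of_le_of_ne ?_ (hne _)
        by_contra hlt
        rw [hs] at hlt
        exact (hf (seq i)).2.2.2 n ih (by omega) hn
    exact absurd (this n) (by simpa using hmono.le_apply (x := n))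
  · rintro ⟨i, rfl⟩; exact (seq i).2
  · simp only [hs]; exact (hf _).2.2.1

end Decompose

/-! ### Infinite concatenations -/

/-- The starting points are the partial sums of the lengths. Since all lengths are positive, each
position lies in exactly one segment, which determines the glued sequence. -/
theorem exists_concat {C : Type*} (n : ℕ → ℕ) (hn : ∀ i, 0 < n i) (f : ℕ → ℕ → C)
    (hf : ∀ i, f i (n i) = f (i + 1) 0) :
    ∃ (ρ : ℕ → C) (pos : ℕ → ℕ), StrictMono pos ∧ pos 0 = 0 ∧
      (∀ i j, j ≤ n i → ρ (pos i + j) = f i j) ∧ (∀ i, pos (i + 1) = pos i + n i) ∧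
      ∀ m, ∃ i j, j < n i ∧ m = pos i + j := by
  let pos : ℕ → ℕ := fun i => ∑ k ∈ Finset.range i, n k
  have hs : ∀ i, pos (i + 1) = pos i + n i := fun i => Finset.sum_range_succ _ _
  have hmono : StrictMono pos := strictMono_nat_of_lt_succ fun i => by
    rw [hs]; have := hn i; omega
  have hex : ∀ m, ∃ i j, j < n i ∧ m = pos i + j := by
    intro m
    induction m with
    | zero => exact ⟨0, 0, hn 0, rfl⟩
    | succ m ih =>
      obtain ⟨i, j, hj, rfl⟩ := ih
      by_cases h : j + 1 < n i
      · exact ⟨i, j + 1, h, by omega⟩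
      · exact ⟨i + 1, 0, hn _, by rw [hs]; omega⟩
  choose I J hJ hIJ using hex
  have key : ∀ i j, j < n i → I (pos i + j) = i ∧ J (pos i + j) = j := by
    intro i j hj
    have h1 := hJ (pos i + j)
    have h2 := hIJ (pos i + j)
    generalize I (pos i + j) = i' at *
    generalize J (pos i + j) = j' at *
    have e1 := hs i
    have e2 := hs i'
    rcases lt_trichotomy i i' with h | h | h
    · have := hmono.monotone (show i + 1 ≤ i' from h); omega
    · subst h; omega
    · have := hmono.monotone (show i' + 1 ≤ i from h); omega
  refine ⟨fun m => f (I m) (J m), pos, hmono, rfl, fun i j hj => ?_, hs,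
    fun m => ⟨I m, J m, hJ m, hIJ m⟩⟩
  rcases hj.lt_or_eq with h | rfl
  · simp only [key i j h]
  · have := key (i + 1) 0 (hn _)
    rw [hs, add_zero] at this
    simp only [this, hf]

theorem exists_fun_of_reflTransGen {C : Type*} {r : C → C → Prop} {a b : C}
    (h : Relation.ReflTransGen r a b) :
    ∃ (n : ℕ) (f : ℕ → C), f 0 = a ∧ f n = b ∧ ∀ j < n, r (f j) (f (j + 1)) := by
  induction h with
  | refl => exact ⟨0, fun _ => a, rfl, rfl, by simp⟩
  | @tail b c _ hbc ih =>
    obtain ⟨n, f, h0, hn, hr⟩ := ih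
    refine ⟨n + 1, fun j => if j ≤ n then f j else c, by simp [h0], by simp, fun j hj => ?_⟩
    rcases (Nat.lt_succ_iff.mp hj).lt_or_eq with h | rfl
    · simpa [h.le, Nat.succ_le_of_lt h] using hr j h
    · simpa [hn] using hbc

theorem exists_fun_of_transGen {C : Type*} {r : C → C → Prop} {a b : C}
    (h : Relation.TransGen r a b) :
    ∃ (n : ℕ) (f : ℕ → C), 0 < n ∧ f 0 = a ∧ f n = b ∧ ∀ j < n, r (f j) (f (j + 1)) := by
  obtain ⟨n, f, h0, hn, hr⟩ := exists_fun_of_reflTransGen h.to_reflTransGen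
  -- The path obtained may be trivial if `a = b`; then the first edge is split off from the
  -- hypothesis to get a positive length.
  rcases Nat.eq_zero_or_pos n with rfl | hpos
  · obtain rfl : a = b := h0.symm.trans hn
    obtain ⟨c, hac, hcb⟩ := Relation.TransGen.head'_iff.mp h
    obtain ⟨m, g, g0, gm, gr⟩ := exists_fun_of_reflTransGen hcb
    refine ⟨m + 1, fun j => if j = 0 then a else g (j - 1), by omega, by simp, by simp [gm], ?_⟩
    intro j hj
    rcases Nat.eq_zero_or_pos j with rfl | hj0
    · simpa [g0] using hac
    · have := gr (j - 1) (by omega)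
      rw [show j - 1 + 1 = j by omega] at this
      simpa [hj0.ne'] using this
  · exact ⟨n, f, hpos, h0, hn, hr⟩

/-- A sequence of points that are linked by nonempty paths extends to an infinite path. -/
theorem exists_path {C : Type*} (r : ℕ → C → C → Prop) (c : ℕ → C)
    (h : ∀ i, Relation.TransGen (r i) (c i) (c (i + 1))) :
    ∃ (s : ℕ → C) (pos : ℕ → ℕ), StrictMono pos ∧ pos 0 = 0 ∧ (∀ i, s (pos i) = c i) ∧
      ∀ m, ∃ i, pos i ≤ m ∧ m < pos (i + 1) ∧ r i (s m) (s (m + 1)) := by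
  choose n f hn h0 hend hr using fun i => exists_fun_of_transGen (h i)
  obtain ⟨s, pos, hmono, hp0, hs, hpos, hex⟩ :=
    exists_concat n hn f fun i => by rw [hend, h0]
  refine ⟨s, pos, hmono, hp0, fun i => ?_, fun m => ?_⟩
  · rw [← h0 i, ← hs i 0 (Nat.zero_le _), add_zero]
  · obtain ⟨i, j, hj, rfl⟩ := hex m
    refine ⟨i, by omega, by rw [hpos]; omega, ?_⟩
    rw [add_assoc, hs i j hj.le, hs i (j + 1) hj]
    exact hr i j hj

/-! ### Runs along paths of edges -/

/-- The two claims need each other: the strict bound for a call with its return is the weak bound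
for the inner word, read above the pushed symbol. -/
theorem Summary.exists_path {A : ParityDVPA Ac Ai Ar Q Γ} {b : Bool} {x y : Q}
    (h : A.Summary b x y) (σ : List Γ) :
    Relation.ReflTransGen (fun C D => A.Next C D ∧ σ.length ≤ D.2.length) (x, σ) (y, σ) ∧
    (b = false → ∃ (n : ℕ) (f : ℕ → Q × List Γ), 0 < n ∧ f 0 = (x, σ) ∧ f n = (y, σ) ∧
      (∀ j < n, A.Next (f j) (f (j + 1))) ∧
      ∀ j, 0 < j → j < n → σ.length < (f j).2.length) := by
  induction h generalizing σ with
  | refl x => exact ⟨.refl, by simp⟩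
  | snoc _ _ ih₁ ih₂ => exact ⟨(ih₁ σ).1.trans (ih₂ σ).1, by simp⟩
  | intern x i =>
    have hm : A.Next (x, σ) (A.δi x i, σ) := ⟨_, .intern x σ i⟩
    refine ⟨.single ⟨hm, le_rfl⟩, fun _ => ⟨1, fun j => if j = 0 then (x, σ) else (A.δi x i, σ),
      one_pos, rfl, rfl, fun j hj => ?_, fun j _ _ => by omega⟩⟩
    obtain rfl : j = 0 := by omega
    simpa using hm
  | nest x c z r _ ih =>
    have h1 := (ih ((A.δc x c).2 :: σ)).1
    have hc : A.Next (x, σ) ((A.δc x c).1, (A.δc x c).2 :: σ) := ⟨_, .call x σ c⟩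
    have hr : A.Next (z, (A.δc x c).2 :: σ) (A.δr z (A.δc x c).2 r, σ) := ⟨_, .ret z _ σ r⟩
    constructor
    · refine .head ⟨hc, by simp⟩ (.tail (Relation.ReflTransGen.mono
        (fun C D hCD => ⟨hCD.1, (Nat.le_succ _).trans hCD.2⟩) _ _ h1) ⟨hr, le_rfl⟩)
    · intro _
      obtain ⟨n, f, h0, hn, hf⟩ := exists_fun_of_reflTransGen h1
      have hlen : ∀ j ≤ n, σ.length < (f j).2.length := by
        intro j hj
        rcases Nat.eq_zero_or_pos j with rfl | hj0
        · simp [h0]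
        · have := (hf (j - 1) (by omega)).2
          rw [show j - 1 + 1 = j by omega] at this
          simpa using this
      refine ⟨n + 2, fun j => if j = 0 then (x, σ) else if j ≤ n + 1 then f (j - 1) else
        (A.δr z (A.δc x c).2 r, σ), by omega, by simp, by simp, fun j hj => ?_, fun j h0 hj => ?_⟩
      · rcases Nat.eq_zero_or_pos j with rfl | hj0
        · simpa [h0] using hc
        · rcases (show j ≤ n ∨ j = n + 1 by omega) with h | rfl
          · have := (hf (j - 1) (by omega)).1
            rw [show j - 1 + 1 = j by omega] at this
            simpa [hj0.ne', show j ≤ n + 1 by omega, h] using this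
          · simpa [hn] using hr
      · simpa [h0.ne', show j ≤ n + 1 by omega] using hlen (j - 1) (by omega)

/-- The final strict inequality ensures that no inner position of the segment becomes a step, since
the stack is lower at the end of the segment. -/
theorem Edge.exists_path {A : ParityDVPA Ac Ai Ar Q Γ} {x y : Q} (h : A.Edge x y) (σ : List Γ) :
    ∃ (τ : List Γ) (n : ℕ) (f : ℕ → Q × List Γ), σ.length ≤ τ.length ∧ 0 < n ∧ f 0 = (x, σ) ∧
      f n = (y, τ) ∧ (∀ j < n, A.Next (f j) (f (j + 1))) ∧
      ∀ j, 0 < j → j < n → τ.length < (f j).2.length := by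
  rcases h with h | ⟨c, rfl⟩
  · obtain ⟨n, f, hf⟩ := (h.exists_path σ).2 rfl
    exact ⟨σ, n, f, le_rfl, hf⟩
  · refine ⟨(A.δc x c).2 :: σ, 1, fun j => if j = 0 then (x, σ) else _, by simp, one_pos, rfl, rfl,
      fun j hj => ?_, fun j _ _ => by omega⟩
    obtain rfl : j = 0 := by omega
    exact ⟨_, .call x σ c⟩

/-- Every infinite path of edges from the initial state is the sequence of the states at the steps
of a run. -/
theorem exists_run_of_edges {A : ParityDVPA Ac Ai Ar Q Γ} (s : ℕ → Q) (h0 : s 0 = A.start)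
    (hs : ∀ i, A.Edge (s i) (s (i + 1))) :
    ∃ w ρ, A.IsRun w ρ ∧ ∃ pos : ℕ → ℕ, StrictMono pos ∧ (∀ n, IsStep ρ n ↔ ∃ i, pos i = n) ∧
      ∀ i, (ρ (pos i)).1 = s i := by
  choose τ n f hle hn hf0 hfn hmove hlen using fun i σ => (hs i).exists_path (Γ := Γ) σ
  -- The stack content at the beginning of the `i`-th segment; its height never decreases.
  let S : ℕ → List Γ := fun i => Nat.rec [] (fun i σ => τ i σ) i
  have hS : ∀ i, S (i + 1) = τ i (S i) := fun i => rfl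
  have hSmono : Monotone fun i => (S i).length := monotone_nat_of_le_succ fun i => by
    simp only [hS]; exact hle _ _
  obtain ⟨ρ, pos, hmono, hp0, hρ, hpos, hex⟩ := exists_concat (fun i => n i (S i))
    (fun i => hn _ _) (fun i => f i (S i)) fun i => by rw [hfn, hf0, hS]
  have hnext : ∀ m, A.Next (ρ m) (ρ (m + 1)) := by
    intro m
    obtain ⟨i, j, hj, rfl⟩ := hex m
    rw [add_assoc, hρ i j hj.le, hρ i (j + 1) hj]
    exact hmove i _ j hj
  have hat : ∀ i, ρ (pos i) = (s i, S i) := fun i => by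
    rw [← hf0 i (S i), ← hρ i 0 (Nat.zero_le _), add_zero]
  choose w hw using hnext
  refine ⟨w, ρ, ⟨?_, hw⟩, pos, hmono, fun m => ⟨fun hm => ?_, ?_⟩, fun i => by rw [hat]⟩
  · have := hat 0
    rw [hp0, h0] at this
    exact this
  · obtain ⟨i, j, hj, rfl⟩ := hex m
    rcases Nat.eq_zero_or_pos j with rfl | hj0
    · exact ⟨i, rfl⟩
    · have h1 := hm (pos (i + 1)) (by rw [hpos]; omega)
      rw [hat, hρ i j hj.le] at h1
      have h2 := hlen i (S i) j hj0 hj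
      simp only [hS] at h1
      omega
  · rintro ⟨i, rfl⟩ m hm
    obtain ⟨i', j, hj, rfl⟩ := hex m
    have hii : i ≤ i' := by
      by_contra hlt
      have := hmono.monotone (show i' + 1 ≤ i by omega)
      rw [hpos] at this
      omega
    have h1 : (S i).length ≤ (S i').length := hSmono hii
    rw [hat, hρ i' j hj.le]
    rcases Nat.eq_zero_or_pos j with rfl | hj0
    · rw [hf0]; exact h1
    · have h2 := hlen i' (S i') j hj0 hj
      have h3 := hle i' (S i')
      simp only
      omega

end ParityDVPA

/-! ### Dominant values of sequences -/

open Filter in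
/-- `k` is the largest value that occurs infinitely often in the sequence `f`, and no larger value
occurs from some position on. -/
def IsDominant (f : ℕ → ℕ) (k : ℕ) : Prop :=
  (∃ᶠ i in atTop, f i = k) ∧ ∀ᶠ i in atTop, f i ≤ k

section Dominant

open Filter

/-- Lower the bound as long as it is attained only finitely often. -/
theorem exists_isDominant {f : ℕ → ℕ} (B : ℕ) (hB : ∀ᶠ i in atTop, f i ≤ B) :
    ∃ k, IsDominant f k := by
  induction B with
  | zero => exact ⟨0, (hB.mono fun i hi => Nat.le_zero.mp hi).frequently, hB⟩
  | succ B ih =>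
    by_cases h : ∃ᶠ i in atTop, f i = B + 1
    · exact ⟨_, h, hB⟩
    · refine ih ?_
      filter_upwards [hB, not_frequently.mp h] with i h1 h2
      omega

theorem IsDominant.isGreatest {f : ℕ → ℕ} {k : ℕ} (h : IsDominant f k) :
    IsGreatest {k | ∃ᶠ i in atTop, f i = k} k :=
  ⟨h.1, fun _ hl => by
    obtain ⟨i, rfl, hi⟩ := (Frequently.and_eventually hl h.2).exists
    exact hi⟩

theorem exists_frequently_eq {α : Type*} [Finite α] {s : ℕ → α} {P : α → Prop}
    (h : ∃ᶠ i in atTop, P (s i)) : ∃ a, P a ∧ ∃ᶠ i in atTop, s i = a := by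
  by_contra hcon
  push Not at hcon
  refine h ?_
  have : ∀ᶠ i in atTop, ∀ a, P a → s i ≠ a := by
    rw [eventually_all]
    intro a
    by_cases ha : P a
    · exact (hcon a ha).mono fun i hi _ => hi
    · exact Eventually.of_forall fun i h => absurd h ha
  exact this.mono fun i hi hP => hi _ hP rfl

theorem eventually_frequently_eq {α : Type*} [Finite α] (s : ℕ → α) :
    ∀ᶠ i in atTop, ∃ᶠ j in atTop, s j = s i := by
  have : ∀ᶠ i in atTop, ∀ a, (¬ ∃ᶠ j in atTop, s j = a) → s i ≠ a := by
    rw [eventually_all]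
    intro a
    by_cases ha : ∃ᶠ j in atTop, s j = a
    · exact Eventually.of_forall fun i h => absurd ha h
    · exact (not_frequently.mp ha).mono fun i hi _ => hi
  exact this.mono fun i hi => by_contra fun h => hi _ h rfl

end Dominant

namespace ParityDVPA

variable {Ac Ai Ar Q Γ Q' Γ' : Type}

/-! ### Acceptance expressed by the dominant priority along the steps. -/

section Language

open Filter

variable {A : ParityDVPA Ac Ai Ar Q Γ}

theorem Move.unique {C D D' : Q × List Γ} {a : VLetter Ac Ai Ar} (h : A.Move C a D)
    (h' : A.Move C a D') : D = D' := by
  cases h <;> cases h' <;> rfl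

theorem IsRun.unique {w : ℕ → VLetter Ac Ai Ar} {ρ ρ' : ℕ → Q × List Γ} (h : A.IsRun w ρ)
    (h' : A.IsRun w ρ') : ρ = ρ' := by
  funext n
  induction n with
  | zero => rw [h.1, h'.1]
  | succ n ih =>
    have := h.2 n
    rw [ih] at this
    exact this.unique (h'.2 n)

theorem infStepPrio_eq {ρ : ℕ → Q × List Γ} {pos : ℕ → ℕ} (hpos : StrictMono pos)
    (hstep : ∀ n, IsStep ρ n ↔ ∃ i, pos i = n) :
    A.infStepPrio ρ = {k | ∃ᶠ i in atTop, A.prio (ρ (pos i)).1 = k} := by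
  ext k
  simp only [infStepPrio, Set.mem_ofPred_eq, Nat.frequently_atTop_iff_infinite]
  have : {n | IsStep ρ n ∧ A.prio (ρ n).1 = k} = pos '' {i | A.prio (ρ (pos i)).1 = k} := by
    ext n
    simp only [Set.mem_ofPred_eq, Set.mem_image, hstep]
    constructor
    · rintro ⟨⟨i, rfl⟩, h⟩; exact ⟨i, h, rfl⟩
    · rintro ⟨i, h, rfl⟩; exact ⟨⟨i, rfl⟩, h⟩
  rw [this, Set.infinite_image_iff hpos.injective.injOn]

theorem mem_stairLanguage_iff {w : ℕ → VLetter Ac Ai Ar} {ρ : ℕ → Q × List Γ} {pos : ℕ → ℕ}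
    (h : A.IsRun w ρ) (hpos : StrictMono pos) (hstep : ∀ n, IsStep ρ n ↔ ∃ i, pos i = n)
    {k : ℕ} (hk : IsDominant (fun i => A.prio (ρ (pos i)).1) k) :
    w ∈ A.stairLanguage ↔ Even k := by
  have hg := hk.isGreatest
  rw [← infStepPrio_eq hpos hstep] at hg
  constructor
  · rintro ⟨ρ', hρ', k', hk', he⟩
    rw [hρ'.unique h] at hk'
    rwa [hg.unique hk']
  · exact fun he => ⟨ρ, h, k, hg, he⟩

end Language

/-! ### Alternating chains -/

/-- An edge between states whose priorities are at most `k`. -/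
def PrioEdge (A : ParityDVPA Ac Ai Ar Q Γ) (k : ℕ) (x y : Q) : Prop :=
  A.Edge x y ∧ A.prio x ≤ k ∧ A.prio y ≤ k

/-- A nonempty path through states whose priorities are at most `k`. -/
def Conn (A : ParityDVPA Ac Ai Ar Q Γ) (k : ℕ) : Q → Q → Prop := Relation.TransGen (A.PrioEdge k)

/-- States that occur on a step of some run. -/
def Reach (A : ParityDVPA Ac Ai Ar Q Γ) : Q → Prop := Relation.ReflTransGen A.Edge A.start

/-- A loop in which `v` has the highest priority can be routed through `u`, and so absorbs loops at
`u` with a smaller maximum of the other parity. -/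
def Prec (A : ParityDVPA Ac Ai Ar Q Γ) (u v : Q) : Prop :=
  A.prio u < A.prio v ∧ A.prio u % 2 ≠ A.prio v % 2 ∧ A.Conn (A.prio v) u v ∧
    A.Conn (A.prio v) v u

/-- `A.Rank b v k`: there is a chain of nested loops, with alternating parities of the highest
priority, that ends with a loop in which `v` has the highest priority. It has `k` members, where
one more is counted if the first parity differs from `b`. -/
inductive Rank (A : ParityDVPA Ac Ai Ar Q Γ) (b : ℕ) : Q → ℕ → Prop
  | base (v : Q) : A.Reach v → A.Conn (A.prio v) v v →
      Rank A b v (1 + (A.prio v % 2 - b) + (b - A.prio v % 2))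
  | step (u v : Q) (k : ℕ) : Rank A b u k → A.Prec u v → Rank A b v (k + 1)

/-- The value `1` is admitted even if no loop is reachable, because every automaton has an initial
state and hence a priority. -/
def Bound (A : ParityDVPA Ac Ai Ar Q Γ) (b k : ℕ) : Prop := k = 1 ∨ ∃ v, A.Rank b v k

/-! ### Elementary properties of ranks. -/

section Rank

variable {A : ParityDVPA Ac Ai Ar Q Γ} {b k l : ℕ} {u v x y : Q}

theorem Conn.mono (h : A.Conn k x y) (hkl : k ≤ l) : A.Conn l x y :=
  Relation.TransGen.mono (fun _ _ h => ⟨h.1, h.2.1.trans hkl, h.2.2.trans hkl⟩) _ _ h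

theorem Reach.conn (hx : A.Reach x) (h : A.Conn k x y) : A.Reach y :=
  hx.trans (Relation.TransGen.mono (p := A.Edge) (fun _ _ h => h.1) _ _ h).to_reflTransGen

theorem Rank.reach_conn (h : A.Rank b v k) : A.Reach v ∧ A.Conn (A.prio v) v v := by
  induction h with
  | base v h h' => exact ⟨h, h'⟩
  | step u v k _ hp ih => exact ⟨ih.1.conn hp.2.2.1, Relation.TransGen.trans hp.2.2.2 hp.2.2.1⟩

/-- The extra member counted in `base` is there for this reason: it gives the colour `b + k - 1` the
parity of the priority of `v`. -/
theorem Rank.parity (hb : b < 2) (h : A.Rank b v k) : 1 ≤ k ∧ (b + k - 1) % 2 = A.prio v % 2 := by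
  induction h with
  | base v h h' => omega
  | step u v k _ hp ih =>
    have := hp.2.1
    omega

/-- The sets of states of priority at most that of the current one grow strictly along a chain. The
additional one pays for the possible extra member at its beginning. -/
theorem Rank.le_ncard [Finite Q] (hb : b < 2) (h : A.Rank b v k) :
    k ≤ {a | A.prio a ≤ A.prio v}.ncard + 1 := by
  induction h with
  | base v h h' =>
    have : 0 < {a | A.prio a ≤ A.prio v}.ncard := (Set.ncard_pos).mpr ⟨v, le_refl (A.prio v)⟩
    omega
  | step u v k _ hp ih =>
    have : {a | A.prio a ≤ A.prio u}.ncard < {a | A.prio a ≤ A.prio v}.ncard := by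
      refine Set.ncard_lt_ncard ⟨fun a ha => le_trans ha hp.1.le, fun hs => ?_⟩
      have : A.prio v ≤ A.prio u := hs (le_refl (A.prio v))
      have := hp.1
      omega
    omega

theorem Rank.le_card [Finite Q] (hb : b < 2) (h : A.Rank b v k) : k ≤ Nat.card Q + 1 :=
  (h.le_ncard hb).trans (Nat.succ_le_succ (Set.ncard_le_card _))

theorem Bound.pos (hb : b < 2) (h : A.Bound b k) : 1 ≤ k := by
  rcases h with rfl | ⟨v, h⟩
  exacts [le_rfl, (h.parity hb).1]

theorem Bound.le_card [Finite Q] (hb : b < 2) (h : A.Bound b k) : k ≤ Nat.card Q + 1 := by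
  rcases h with rfl | ⟨v, h⟩
  exacts [by omega, h.le_card hb]

/-- Removing the last loop of a chain lowers its value by one. A single loop has value `1` or `2`,
and `1` is always admitted. -/
theorem Bound.anti (hb : b < 2) (h : A.Bound b k) (hl : 1 ≤ l) (hlk : l ≤ k) : A.Bound b l := by
  rcases h with rfl | ⟨v, h⟩
  · exact .inl (by omega)
  · induction h with
    | base v h h' =>
      rcases (show l = 1 ∨ l = 1 + (A.prio v % 2 - b) + (b - A.prio v % 2) by omega) with rfl | rfl
      exacts [.inl rfl, .inr ⟨v, .base v h h'⟩]
    | step u v k hu hp ih =>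
      rcases hlk.lt_or_eq with h | rfl
      exacts [ih (by omega), .inr ⟨v, .step u v k hu hp⟩]

/-- If the parities agree, `v` can replace `u` at the end of the chain; otherwise `v` can be
appended. -/
theorem Rank.exists_le (h : A.Rank b u k) (huv : A.prio u ≤ A.prio v)
    (h₁ : A.Conn (A.prio v) u v) (h₂ : A.Conn (A.prio v) v u) : ∃ l, k ≤ l ∧ A.Rank b v l := by
  by_cases hpar : A.prio u % 2 = A.prio v % 2
  · cases h with
    | base _ hr hc =>
      refine ⟨_, le_rfl, ?_⟩
      rw [hpar]
      exact .base v (hr.conn h₁) (Relation.TransGen.trans h₂ h₁)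
    | step u' _ k hu hp =>
      exact ⟨_, le_rfl, .step u' v k hu ⟨hp.1.trans_le huv, hpar ▸ hp.2.1,
        Relation.TransGen.trans (hp.2.2.1.mono huv) h₁,
        Relation.TransGen.trans h₂ (hp.2.2.2.mono huv)⟩⟩
  · exact ⟨k + 1, by omega, .step u v k h
      ⟨lt_of_le_of_ne huv fun h => hpar (by rw [h]), hpar, h₁, h₂⟩⟩

end Rank

/-! ### An automaton with few priorities -/

section Recolor

variable (A : ParityDVPA Ac Ai Ar Q Γ)

/-- The automaton `A` with another priority function. -/
def withPrio (f : Q → ℕ) : ParityDVPA Ac Ai Ar Q Γ := { A with prio := f }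

theorem move_withPrio (f : Q → ℕ) {C D : Q × List Γ} {a : VLetter Ac Ai Ar} :
    (A.withPrio f).Move C a D ↔ A.Move C a D := by
  constructor
  · intro h
    cases h with
    | call q σ c => exact .call q σ c
    | intern q σ i => exact .intern q σ i
    | ret q Z σ r => exact .ret q Z σ r
  · intro h
    cases h with
    | call q σ c => exact .call (A := A.withPrio f) q σ c
    | intern q σ i => exact .intern (A := A.withPrio f) q σ i
    | ret q Z σ r => exact .ret (A := A.withPrio f) q Z σ r

theorem isRun_withPrio (f : Q → ℕ) {w : ℕ → VLetter Ac Ai Ar} {ρ : ℕ → Q × List Γ} :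
    (A.withPrio f).IsRun w ρ ↔ A.IsRun w ρ := by
  simp only [IsRun, move_withPrio]; rfl

open Classical in
/-- The priority function that belongs to the ranks of the states. -/
noncomputable def rankPrio (b : ℕ) (v : Q) : ℕ :=
  if ∃ k, A.Rank b v k then b + sSup {k | A.Rank b v k} - 1 else b

variable {A}

theorem rankPrio_of_rank [Finite Q] {b : ℕ} (hb : b < 2) {v : Q} (h : ∃ k, A.Rank b v k) :
    ∃ k, A.Rank b v k ∧ (∀ l, A.Rank b v l → l ≤ k) ∧ A.rankPrio b v = b + k - 1 := by
  have hbdd : BddAbove {k | A.Rank b v k} := ⟨_, fun k hk => hk.le_card hb⟩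
  exact ⟨_, Nat.sSup_mem h hbdd, fun l hl => le_csSup hbdd hl, if_pos h⟩

-- Let `v` recur with the dominant priority. Every other recurrent state lies on a common loop with
-- `v` below that priority, so `Rank.exists_le` bounds its rank by that of `v`. States without rank
-- get the smallest colour `b`.
open Filter in
theorem isDominant_rankPrio [Finite Q] {b : ℕ} (hb : b < 2) {s : ℕ → Q} (h0 : s 0 = A.start)
    (hs : ∀ i, A.Edge (s i) (s (i + 1))) {m : ℕ} (hm : IsDominant (fun i => A.prio (s i)) m) :
    ∃ l, IsDominant (fun i => A.rankPrio b (s i)) l ∧ (Even l ↔ Even m) := by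
  obtain ⟨v, rfl, hv⟩ := exists_frequently_eq (P := fun a => A.prio a = m) hm.1
  have hreach : ∀ i, A.Reach (s i) := by
    intro i
    induction i with
    | zero => rw [h0]; exact .refl
    | succ i ih => exact ih.tail (hs i)
  obtain ⟨N, hN⟩ := eventually_atTop.mp hm.2
  have hconn : ∀ i, N ≤ i → ∀ d, A.Conn (A.prio v) (s i) (s (i + d + 1)) := by
    intro i hi d
    induction d with
    | zero => exact .single ⟨hs i, hN i hi, hN _ (by omega)⟩
    | succ d ih => exact ih.tail ⟨hs _, hN _ (by omega), hN _ (by omega)⟩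
  have hconn' : ∀ a a', (∃ᶠ i in atTop, s i = a) → (∃ᶠ i in atTop, s i = a') →
      A.Conn (A.prio v) a a' := by
    intro a a' ha ha'
    obtain ⟨i, hi, rfl⟩ := frequently_atTop.mp ha N
    obtain ⟨j, hj, rfl⟩ := frequently_atTop.mp ha' (i + 1)
    obtain ⟨d, rfl⟩ := Nat.exists_eq_add_of_le hj
    rw [show i + 1 + d = i + d + 1 by omega]
    exact hconn i hi d
  obtain ⟨i, rfl⟩ := hv.exists
  have hrank : A.Rank b (s i) _ := .base _ (hreach i) (hconn' _ _ hv hv)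
  obtain ⟨k, hk, hmax, hval⟩ := rankPrio_of_rank hb ⟨_, hrank⟩
  have hpar := hk.parity hb
  refine ⟨A.rankPrio b (s i), ⟨hv.mono fun j hj => by simp only [hj], ?_⟩, ?_⟩
  · filter_upwards [eventually_frequently_eq s, hm.2] with j hj hle
    by_cases hr : ∃ l, A.Rank b (s j) l
    · obtain ⟨l, hl, -, hval'⟩ := rankPrio_of_rank hb hr
      obtain ⟨l', hl', hr'⟩ := hl.exists_le hle (hconn' _ _ hj hv) (hconn' _ _ hv hj)
      have := hmax l' hr'
      omega
    · rw [hval, rankPrio, if_neg hr]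
      omega
  · rw [hval, Nat.even_iff, Nat.even_iff, hpar.2]

/-- Runs do not depend on the priorities, so the steps are unchanged; the new colours lie in an
interval of length `K`. -/
theorem exists_numPrio_le [Finite Q] {b K : ℕ} (hb : b < 2) (hK : ∀ k, A.Bound b k → k ≤ K) :
    (A.withPrio (A.rankPrio b)).stairLanguage = A.stairLanguage ∧
      (A.withPrio (A.rankPrio b)).numPrio ≤ K := by
  constructor
  · ext w
    by_cases hw : ∃ ρ, A.IsRun w ρ
    · obtain ⟨ρ, hρ⟩ := hw
      obtain ⟨pos, hmono, hp0, hstep, hedge⟩ := hρ.exists_steps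
      obtain ⟨B, hB⟩ := (Set.finite_range A.prio).bddAbove
      obtain ⟨m, hm⟩ := exists_isDominant (f := fun i => A.prio (ρ (pos i)).1) B
        (.of_forall fun i => hB ⟨_, rfl⟩)
      obtain ⟨l, hl, hlm⟩ := isDominant_rankPrio hb (by rw [hp0, hρ.1]) hedge hm
      rw [mem_stairLanguage_iff hρ hmono hstep hm, ← hlm]
      exact mem_stairLanguage_iff ((A.isRun_withPrio _).mpr hρ) hmono hstep hl
    · constructor
      · rintro ⟨ρ, hρ, -⟩; exact absurd ⟨ρ, (A.isRun_withPrio _).mp hρ⟩ hw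
      · rintro ⟨ρ, hρ, -⟩; exact absurd ⟨ρ, hρ⟩ hw
  · have hsub : Set.range (A.withPrio (A.rankPrio b)).prio ⊆ Set.Ico b (b + K) := by
      rintro _ ⟨v, rfl⟩
      change A.rankPrio b v ∈ _
      have h1 := hK 1 (.inl rfl)
      by_cases hr : ∃ l, A.Rank b v l
      · obtain ⟨l, hl, -, hval⟩ := rankPrio_of_rank hb hr
        have h2 := hK l (.inr ⟨v, hl⟩)
        have := (hl.parity hb).1
        rw [hval, Set.mem_Ico]; omega
      · rw [rankPrio, if_neg hr, Set.mem_Ico]; omega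
    calc _ ≤ (Set.Ico b (b + K)).ncard := Set.ncard_le_ncard hsub
      _ = K := by rw [Set.ncard_eq_toFinset_card']; simp

end Recolor

/-! ### The lower bound -/

section Product

variable (A : ParityDVPA Ac Ai Ar Q Γ) (B : ParityDVPA Ac Ai Ar Q' Γ')

/-- Two machines that run in parallel; the priorities are irrelevant. -/
def prod : ParityDVPA Ac Ai Ar (Q × Q') (Γ × Γ') where
  start := (A.start, B.start)
  δc z c := (((A.δc z.1 c).1, (B.δc z.2 c).1), ((A.δc z.1 c).2, (B.δc z.2 c).2))
  δi z i := (A.δi z.1 i, B.δi z.2 i)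
  δr z Z r := (A.δr z.1 Z.1 r, B.δr z.2 Z.2 r)
  prio _ := 0

variable {A B}

theorem IsRun.fst {w : ℕ → VLetter Ac Ai Ar} {ρ : ℕ → (Q × Q') × List (Γ × Γ')}
    (h : (A.prod B).IsRun w ρ) : A.IsRun w fun n => ((ρ n).1.1, (ρ n).2.map Prod.fst) := by
  refine ⟨by simp only [h.1]; rfl, fun n => ?_⟩
  have := h.2 n
  dsimp only
  generalize ρ n = C at *
  generalize ρ (n + 1) = D at *
  generalize w n = a at *
  cases this with
  | call q σ c => exact .call _ _ c
  | intern q σ i => exact .intern _ _ i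
  | ret q Z σ r => exact .ret _ _ _ r

theorem IsRun.snd {w : ℕ → VLetter Ac Ai Ar} {ρ : ℕ → (Q × Q') × List (Γ × Γ')}
    (h : (A.prod B).IsRun w ρ) : B.IsRun w fun n => ((ρ n).1.2, (ρ n).2.map Prod.snd) := by
  refine ⟨by simp only [h.1]; rfl, fun n => ?_⟩
  have := h.2 n
  dsimp only
  generalize ρ n = C at *
  generalize ρ (n + 1) = D at *
  generalize w n = a at *
  cases this with
  | call q σ c => exact .call _ _ c
  | intern q σ i => exact .intern _ _ i
  | ret q Z σ r => exact .ret _ _ _ r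

/-- The second machine can read the same well-matched word from any state: its transition functions
are total, and a matched return never meets the empty stack. -/
theorem Summary.lift {o : Bool} {x y : Q} (h : A.Summary o x y) :
    ∀ t : Q', ∃ t', (A.prod B).Summary o (x, t) (y, t') := by
  induction h with
  | refl x => exact fun t => ⟨t, .refl _⟩
  | snoc _ _ ih₁ ih₂ =>
    intro t
    obtain ⟨t₁, h₁⟩ := ih₁ t
    obtain ⟨t₂, h₂⟩ := ih₂ t₁
    exact ⟨t₂, h₁.snoc h₂⟩
  | intern x i => exact fun t => ⟨_, .intern (A := A.prod B) (x, t) i⟩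
  | nest x c z r _ ih =>
    intro t
    obtain ⟨t₁, h₁⟩ := ih (B.δc t c).1
    exact ⟨_, .nest (A := A.prod B) (x, t) c (z, t₁) r h₁⟩

theorem Edge.lift {x y : Q} (h : A.Edge x y) (t : Q') : ∃ t', (A.prod B).Edge (x, t) (y, t') := by
  rcases h with h | ⟨c, rfl⟩
  · obtain ⟨t', h'⟩ := h.lift (B := B) t
    exact ⟨t', .inl h'⟩
  · exact ⟨_, .inr ⟨c, rfl⟩⟩

theorem Reach.lift {x : Q} (h : A.Reach x) : ∃ t, (A.prod B).Reach (x, t) := by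
  induction h with
  | refl => exact ⟨B.start, .refl⟩
  | tail _ h ih =>
    obtain ⟨t, ht⟩ := ih
    obtain ⟨t', ht'⟩ := h.lift (B := B) t
    exact ⟨t', ht.tail ht'⟩

/-- An edge of the product that stays among the states that are connected with `v` in both
directions through states whose priorities are at most that of `v`. -/
def LoopEdge (A : ParityDVPA Ac Ai Ar Q Γ) (B : ParityDVPA Ac Ai Ar Q' Γ') (v : Q)
    (z z' : Q × Q') : Prop :=
  (A.prod B).Edge z z' ∧ A.Conn (A.prio v) v z'.1 ∧ A.Conn (A.prio v) z'.1 v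

theorem Conn.lift {v x y : Q} (h : A.Conn (A.prio v) x y) (hx : A.Conn (A.prio v) v x)
    (hy : A.Conn (A.prio v) y v) (t : Q') :
    ∃ t', Relation.TransGen (A.LoopEdge B v) (x, t) (y, t') := by
  induction h using Relation.TransGen.head_induction_on generalizing t with
  | single h =>
    obtain ⟨t', ht'⟩ := h.1.lift (B := B) t
    exact ⟨t', .single ⟨ht', hx.tail h, hy⟩⟩
  | head h hc ih =>
    obtain ⟨t₁, ht₁⟩ := h.1.lift (B := B) t
    obtain ⟨t₂, ht₂⟩ := ih (hx.tail h) t₁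
    exact ⟨t₂, .head ⟨ht₁, hx.tail h, Relation.TransGen.trans hc hy⟩ ht₂⟩

theorem LoopEdge.conn {v : Q} {z z' : Q × Q'} (h : Relation.ReflTransGen (A.LoopEdge B v) z z')
    (h₁ : A.Conn (A.prio v) v z.1) (h₂ : A.Conn (A.prio v) z.1 v) :
    A.Conn (A.prio v) v z'.1 ∧ A.Conn (A.prio v) z'.1 v := by
  cases h with
  | refl => exact ⟨h₁, h₂⟩
  | tail _ h => exact h.2

theorem Conn.prio_le {k : ℕ} {x y : Q} (h : A.Conn k x y) : A.prio x ≤ k := by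
  obtain ⟨_, h, -⟩ := Relation.TransGen.head'_iff.mp h
  exact h.2.1

-- A run of the product along `s` projects to runs of `A` and `B` on one word. The projections keep
-- the stack heights, so both runs have the same steps, and the two dominant values decide
-- membership of the word in the same language.
open Filter in
theorem parity_eq_of_stairLanguage_eq (hL : B.stairLanguage = A.stairLanguage)
    {s : ℕ → Q × Q'} (h0 : s 0 = (A.prod B).start) (hs : ∀ i, (A.prod B).Edge (s i) (s (i + 1)))
    {m x : ℕ} (hm : IsDominant (fun i => A.prio (s i).1) m)
    (hx : IsDominant (fun i => B.prio (s i).2) x) : x % 2 = m % 2 := by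
  obtain ⟨w, ρ, hρ, pos, hmono, hstep, hpos⟩ := exists_run_of_edges s h0 hs
  have hA := mem_stairLanguage_iff (k := m) hρ.fst hmono
    (fun n => by rw [← hstep]; simp [IsStep]) (by simpa [hpos] using hm)
  have hB := mem_stairLanguage_iff (k := x) hρ.snd hmono
    (fun n => by rw [← hstep]; simp [IsStep]) (by simpa [hpos] using hx)
  rw [hL, hA, Nat.even_iff, Nat.even_iff] at hB
  omega

-- Let `x` be the least bound on the priorities of `B` that holds in the part of the region
-- reachable from some `z`. By minimality `x` stays attainable from everywhere in that part, and so
-- does `v`. A path that visits both infinitely often has dominant value `A.prio v` in `A` and `x`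
-- in `B`.
open Filter in
theorem exists_loop_value [Finite Q'] (hL : B.stairLanguage = A.stairLanguage) {v : Q}
    (hv : A.Conn (A.prio v) v v) {t : Q'} (ht : (A.prod B).Reach (v, t)) :
    ∃ (z : Q × Q') (x : ℕ), Relation.ReflTransGen (A.LoopEdge B v) (v, t) z ∧
      (∀ z', Relation.ReflTransGen (A.LoopEdge B v) z z' → B.prio z'.2 ≤ x) ∧
      (∃ z', Relation.ReflTransGen (A.LoopEdge B v) z z' ∧ B.prio z'.2 = x) ∧
      x % 2 = A.prio v % 2 := by
  classical
  let R := Relation.ReflTransGen (A.LoopEdge B v)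
  have hex : ∃ x, ∃ z, R (v, t) z ∧ ∀ z', R z z' → B.prio z'.2 ≤ x := by
    obtain ⟨M, hM⟩ := (Set.finite_range B.prio).bddAbove
    exact ⟨M, (v, t), .refl, fun z' _ => hM ⟨_, rfl⟩⟩
  obtain ⟨z, hz, hzx⟩ := Nat.find_spec hex
  have hmin := fun y (hy : y < Nat.find hex) => Nat.find_min hex hy
  generalize Nat.find hex = x at *
  -- Otherwise `x - 1` would bound the priorities reachable from `z₁`, or `x = 0` would be attained
  -- by `z₁` itself.
  have hval : ∀ z₁, R z z₁ → ∃ z', R z₁ z' ∧ B.prio z'.2 = x := by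
    intro z₁ h₁
    by_contra hcon
    push Not at hcon
    rcases Nat.eq_zero_or_pos x with rfl | hx
    · exact hcon z₁ .refl (Nat.le_zero.mp (hzx z₁ h₁))
    · refine hmin (x - 1) (by omega) ⟨z₁, hz.trans h₁, fun z' hz' => ?_⟩
      have := hzx z' (h₁.trans hz')
      have := hcon z' hz'
      omega
  have hcv : ∀ z₁, R z z₁ → A.Conn (A.prio v) v z₁.1 ∧ A.Conn (A.prio v) z₁.1 v :=
    fun z₁ h => LoopEdge.conn (hz.trans h) hv hv
  refine ⟨z, x, hz, hzx, hval z .refl, ?_⟩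
  have tov : ∀ z₁ : {z₁ // R z z₁}, ∃ z₂ : {z₂ // R z z₂},
      Relation.TransGen (A.LoopEdge B v) z₁ z₂ ∧ z₂.1.1 = v := by
    rintro ⟨z₁, h₁⟩
    obtain ⟨t', ht'⟩ := (hcv z₁ h₁).2.lift (B := B) (hcv z₁ h₁).1 hv z₁.2
    exact ⟨⟨(v, t'), Relation.ReflTransGen.trans h₁ ht'.to_reflTransGen⟩, ht', rfl⟩
  have tox : ∀ z₁ : {z₁ // R z z₁}, ∃ z₂ : {z₂ // R z z₂},
      Relation.TransGen (A.LoopEdge B v) z₁ z₂ ∧ B.prio z₂.1.2 = x := by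
    intro z₁
    obtain ⟨z₂, h₂, -⟩ := tov z₁
    obtain ⟨z₃, h₃, hx⟩ := hval z₂ z₂.2
    exact ⟨⟨z₃, z₂.2.trans h₃⟩, h₂.trans_left h₃, hx⟩
  choose gv hgv hgv' using tov
  choose gx hgx hgx' using tox
  -- The targets are visited alternately: a pair with priority `x` in `B`, then a pair over `v`.
  let c' : ℕ → {z₁ // R z z₁} := fun i =>
    Nat.rec (gv ⟨z, .refl⟩) (fun i y => if Even i then gx y else gv y) i
  have hc' : ∀ i, c' (i + 1) = if Even i then gx (c' i) else gv (c' i) := fun i => rfl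
  -- The segment with index `0` leads from the initial state into the region, where all later
  -- segments stay.
  obtain ⟨s, pos, hmono, hp0, hpos, hr⟩ := exists_path
    (fun i => if i = 0 then (A.prod B).Edge else A.LoopEdge B v)
    (fun i => Nat.casesOn i (A.prod B).start fun i => (c' i).1) (by
      intro i
      rcases i with _ | i
      · have h1 : Relation.ReflTransGen (A.prod B).Edge (v, t) z :=
          Relation.ReflTransGen.mono (fun _ _ h => h.1) _ _ hz
        have h2 : Relation.TransGen (A.prod B).Edge z (c' 0).1 :=
          Relation.TransGen.mono (fun _ _ h => h.1) _ _ (hgv ⟨z, .refl⟩)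
        exact Relation.TransGen.trans_right (Relation.ReflTransGen.trans ht h1) h2
      · simp only [Nat.succ_ne_zero, if_false, hc']
        split_ifs
        exacts [hgx _, hgv _])
  have hedge : ∀ i, (A.prod B).Edge (s i) (s (i + 1)) := by
    intro m
    obtain ⟨i, -, -, h⟩ := hr m
    rcases i with _ | i
    · exact h
    · exact h.1
  have hreg : ∀ m, pos 1 ≤ m → R z (s m) := by
    intro m hm
    induction m, hm using Nat.le_induction with
    | base => rw [hpos]; exact (c' 0).2
    | succ m hm ih =>
      obtain ⟨i, h1, h2, h⟩ := hr m
      rcases i with _ | i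
      · rw [zero_add] at h2; omega
      · exact ih.tail h
  refine parity_eq_of_stairLanguage_eq hL (s := s) (by rw [← hp0, hpos]; rfl) hedge
    ⟨?_, ?_⟩ ⟨?_, ?_⟩
  · refine frequently_atTop.mpr fun a => ⟨pos (2 * a + 1 + 2), ?_, ?_⟩
    · have := hmono.le_apply (x := 2 * a + 1 + 2); omega
    · simp only [hpos]
      change A.prio (c' (2 * a + 1 + 1)).1.1 = _
      rw [hc', if_neg (by simp), hgv']
  · exact eventually_atTop.mpr ⟨pos 1, fun m hm => (hcv _ (hreg m hm)).2.prio_le⟩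
  · refine frequently_atTop.mpr fun a => ⟨pos (2 * a + 2), ?_, ?_⟩
    · have := hmono.le_apply (x := 2 * a + 2); omega
    · simp only [hpos]
      rw [hc', if_pos (by simp), hgx']
  · exact eventually_atTop.mpr ⟨pos 1, fun m hm => hzx _ (hreg m hm)⟩

/-- Induction on the chain. The final minimality clause makes the induction work: the region of `u`,
entered from that of `v`, lies inside it, so the priority found for `u` is at most the one for `v`,
and the parities exclude equality. At the first loop, if its parity is not that of the smallest
priority of `B`, this smallest priority is counted as well. -/
theorem Rank.exists_prio [Finite Q'] (hL : B.stairLanguage = A.stairLanguage) {v : Q} {k : ℕ}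
    (h : A.Rank (sInf (Set.range B.prio) % 2) v k) :
    ∀ t, (A.prod B).Reach (v, t) → ∃ x ∈ Set.range B.prio, x % 2 = A.prio v % 2 ∧
      k ≤ (Set.range B.prio ∩ Set.Iic x).ncard ∧
      ∀ y, (∀ z, Relation.ReflTransGen (A.LoopEdge B v) (v, t) z → B.prio z.2 ≤ y) → x ≤ y := by
  have hfin : (Set.range B.prio).Finite := Set.finite_range _
  induction h with
  | base v hr hc =>
    intro t ht
    obtain ⟨z, x, hz, hzx, ⟨z', hz', hx⟩, hpar⟩ := exists_loop_value hL hc ht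
    refine ⟨x, ⟨_, hx⟩, hpar, ?_, fun y hy => hx ▸ hy _ (hz.trans hz')⟩
    have hxmem : x ∈ Set.range B.prio := ⟨_, hx⟩
    have hmin : sInf (Set.range B.prio) ∈ Set.range B.prio := Nat.sInf_mem ⟨x, hxmem⟩
    have hle : sInf (Set.range B.prio) ≤ x := Nat.sInf_le hxmem
    generalize sInf (Set.range B.prio) = n at *
    by_cases hn : n % 2 = A.prio v % 2
    · have : 0 < (Set.range B.prio ∩ Set.Iic x).ncard :=
        (Set.ncard_pos (hfin.inter_of_left _)).mpr ⟨x, hxmem, le_refl x⟩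
      omega
    · have h2 : ({n, x} : Set ℕ).ncard ≤ (Set.range B.prio ∩ Set.Iic x).ncard := by
        refine Set.ncard_le_ncard ?_ (hfin.inter_of_left _)
        rintro y (rfl | rfl)
        exacts [⟨hmin, hle⟩, ⟨hxmem, le_refl y⟩]
      rw [Set.ncard_pair (by rintro rfl; exact hn hpar)] at h2
      omega
  | step u v k hu hp ih =>
    intro t ht
    have hc : A.Conn (A.prio v) v v := Relation.TransGen.trans hp.2.2.2 hp.2.2.1
    obtain ⟨z, x, hz, hzx, ⟨z', hz', hx⟩, hpar⟩ := exists_loop_value hL hc ht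
    refine ⟨x, ⟨_, hx⟩, hpar, ?_, fun y hy => hx ▸ hy _ (hz.trans hz')⟩
    have hzv := LoopEdge.conn hz hc hc
    -- The loop at `u` is entered only after `z`, from where `x` bounds all priorities.
    obtain ⟨t', ht'⟩ := Conn.lift (B := B) (Relation.TransGen.trans hzv.2 hp.2.2.2) hzv.1 hp.2.2.1 z.2
    have hzu := ht'.to_reflTransGen
    obtain ⟨xu, hxu, hparu, hku, hbu⟩ := ih t' (Relation.ReflTransGen.trans ht
      (Relation.ReflTransGen.mono (fun _ _ h => h.1) _ _ (hz.trans hzu)))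
    have hle : xu ≤ x := hbu x fun z' hz' => hzx z' (hzu.trans
      (Relation.ReflTransGen.mono (fun _ _ h => ⟨h.1,
        Relation.TransGen.trans hp.2.2.2 (h.2.1.mono hp.1.le),
        Relation.TransGen.trans (h.2.2.mono hp.1.le) hp.2.2.1⟩) _ _ hz'))
    have hne : xu ≠ x := by
      rintro rfl
      exact hp.2.1 (hparu.symm.trans hpar)
    have : (Set.range B.prio ∩ Set.Iic xu).ncard < (Set.range B.prio ∩ Set.Iic x).ncard := by
      refine Set.ncard_lt_ncard ⟨fun y hy => ⟨hy.1, le_trans hy.2 hle⟩, fun hs => ?_⟩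
        (hfin.inter_of_left _)
      have : x ≤ xu := (hs ⟨⟨_, hx⟩, le_refl x⟩).2
      omega
    omega

theorem exists_bound_le_numPrio [Finite Q'] (hL : B.stairLanguage = A.stairLanguage) :
    ∃ b < 2, ∀ k, A.Bound b k → k ≤ B.numPrio := by
  refine ⟨_, Nat.mod_lt (sInf (Set.range B.prio)) two_pos, fun k hk => ?_⟩
  have hfin : (Set.range B.prio).Finite := Set.finite_range _
  rcases hk with rfl | ⟨v, hk⟩
  · exact (Set.ncard_pos hfin).mpr ⟨_, B.start, rfl⟩
  · obtain ⟨t, ht⟩ := hk.reach_conn.1.lift (B := B)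
    obtain ⟨x, -, -, hle, -⟩ := hk.exists_prio hL t ht
    exact hle.trans (Set.ncard_le_ncard Set.inter_subset_left hfin)

end Product

/-- For each `b` the bounds are downward closed, so the greatest common bound is the smaller of the
two maxima. An equivalent automaton respects all bounds for one `b`, and recolouring attains the
smaller maximum. -/
theorem isStairParityIndex_of_isGreatest [Finite Q] [Finite Γ] {A : ParityDVPA Ac Ai Ar Q Γ}
    {k : ℕ} (hk : IsGreatest {j | A.Bound 0 j ∧ A.Bound 1 j} k) : A.IsStairParityIndex k := by
  have hlow : ∀ {Q' Γ' : Type} [Finite Q'] (B : ParityDVPA Ac Ai Ar Q' Γ'),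
      B.stairLanguage = A.stairLanguage → k ≤ B.numPrio := by
    intro Q' Γ' _ B hL
    obtain ⟨b, hb, h⟩ := exists_bound_le_numPrio hL
    interval_cases b
    exacts [h k hk.1.1, h k hk.1.2]
  have hup : ∃ b < 2, ∀ j, A.Bound b j → j ≤ k := by
    by_contra hcon
    push Not at hcon
    obtain ⟨i, hi, hik⟩ := hcon 0 (by norm_num)
    obtain ⟨j, hj, hjk⟩ := hcon 1 (by norm_num)
    have : k + 1 ≤ k := hk.2 ⟨hi.anti (by norm_num) (by omega) hik,
      hj.anti (by norm_num) (by omega) hjk⟩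
    omega
  obtain ⟨b, hb, h⟩ := hup
  obtain ⟨hL, hn⟩ := exists_numPrio_le hb h
  refine ⟨⟨Q, Γ, inferInstance, inferInstance, _, hL, le_antisymm hn (hlow _ hL)⟩, ?_⟩
  rintro n ⟨Q', Γ', _, _, B, hB, rfl⟩
  exact hlow B hB

-- The common bounds form the interval from `1` to the index, so the index can be found by counting
-- them. No bound exceeds `Nat.card Q + 1`, so none is cut off.
open Classical in
theorem isStairParityIndex_card [Finite Q] [Finite Γ] (A : ParityDVPA Ac Ai Ar Q Γ) {n : ℕ}
    (hn : Nat.card Q + 2 ≤ n) :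
    A.IsStairParityIndex {j ∈ Finset.range n | A.Bound 0 j ∧ A.Bound 1 j}.card := by
  have h1 : ∃ j, 1 ≤ j ∧ A.Bound 0 j ∧ A.Bound 1 j := ⟨1, le_rfl, .inl rfl, .inl rfl⟩
  have hbdd : BddAbove {j | A.Bound 0 j ∧ A.Bound 1 j} := ⟨_, fun j hj => hj.1.le_card (by norm_num)⟩
  have hg : IsGreatest {j | A.Bound 0 j ∧ A.Bound 1 j} (sSup {j | A.Bound 0 j ∧ A.Bound 1 j}) :=
    ⟨Nat.sSup_mem ⟨1, .inl rfl, .inl rfl⟩ hbdd, fun j hj => le_csSup hbdd hj⟩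
  generalize sSup {j | A.Bound 0 j ∧ A.Bound 1 j} = k at *
  convert isStairParityIndex_of_isGreatest hg
  have : {j ∈ Finset.range n | A.Bound 0 j ∧ A.Bound 1 j} = Finset.Icc 1 k := by
    ext j
    simp only [Finset.mem_filter, Finset.mem_range, Finset.mem_Icc]
    constructor
    · rintro ⟨-, h⟩
      exact ⟨h.1.pos (by norm_num), hg.2 h⟩
    · rintro ⟨h1, h2⟩
      have := hg.1.1.le_card (by norm_num)
      exact ⟨by omega, hg.1.1.anti (by norm_num) h1 h2, hg.1.2.anti (by norm_num) h1 h2⟩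
  rw [this]; simp

end ParityDVPA

/-! ### Programs that evaluate expressions -/

namespace RAM

/-- `P` halts within `T` steps when it is started in `s`, and the final state is `s'`. -/
def Runs (P : Prog) (T : ℕ) (s s' : State) : Prop := ∃ t ≤ T, Exec P s t s'

section Runs

variable {P P₁ P₂ : Prog} {T T' T₁ T₂ a : ℕ} {s s₁ s₂ : State}

theorem Exec.runs {t : ℕ} (h : Exec P s t s₁) : Runs P t s s₁ := ⟨t, le_rfl, h⟩

theorem Runs.mono (h : Runs P T s s₁) (hT : T ≤ T') : Runs P T' s s₁ :=
  h.imp fun _ h => ⟨h.1.trans hT, h.2⟩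

theorem Runs.seq (h₁ : Runs P₁ T₁ s s₁) (h₂ : Runs P₂ T₂ s₁ s₂) :
    Runs (.seq P₁ P₂) (T₁ + T₂) s s₂ := by
  obtain ⟨t₁, ht₁, e₁⟩ := h₁
  obtain ⟨t₂, ht₂, e₂⟩ := h₂
  exact ⟨_, Nat.add_le_add ht₁ ht₂, .seq e₁ e₂⟩

theorem Runs.cond_true (ha : s.reg a ≠ 0) (h : Runs P₁ T s s₁) :
    Runs (.cond a P₁ P₂) (T + 1) s s₁ := by
  obtain ⟨t, ht, e⟩ := h
  exact ⟨_, Nat.succ_le_succ ht, .cond_true ha e⟩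

theorem Runs.cond_false (ha : s.reg a = 0) (h : Runs P₂ T s s₁) :
    Runs (.cond a P₁ P₂) (T + 1) s s₁ := by
  obtain ⟨t, ht, e⟩ := h
  exact ⟨_, Nat.succ_le_succ ht, .cond_false ha e⟩

/-- `J n` is an invariant of a loop at the times when `n` rounds remain. -/
theorem runs_loop (J : ℕ → State → Prop) (hreg : ∀ n s, J n s → s.reg a = n)
    (hstep : ∀ n s, J (n + 1) s → ∃ s', Runs P T s s' ∧ J n s') (n : ℕ) :
    ∀ s, J n s → ∃ s', Runs (.loop a P) (n * (T + 1) + 1) s s' ∧ J 0 s' := by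
  induction n with
  | zero => exact fun s hs => ⟨s, ⟨1, by omega, .loop_done (hreg 0 s hs)⟩, hs⟩
  | succ n ih =>
    intro s hs
    obtain ⟨s₁, ⟨t₁, ht₁, e₁⟩, h₁⟩ := hstep n s hs
    obtain ⟨s₂, ⟨t₂, ht₂, e₂⟩, h₂⟩ := ih s₁ h₁
    refine ⟨s₂, ⟨_, ?_, .loop_next (by rw [hreg _ _ hs]; omega) e₁ e₂⟩, h₂⟩
    rw [Nat.succ_mul]
    omega

end Runs

@[simp] theorem State.setReg_reg (s : State) (d v i : ℕ) :
    (s.setReg d v).reg i = if i = d then v else s.reg i := by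
  simp [State.setReg, Function.update_apply]

@[simp] theorem State.setReg_mem (s : State) (d v : ℕ) : (s.setReg d v).mem = s.mem := rfl

@[simp] theorem State.setMem_mem (s : State) (d v i : ℕ) :
    (s.setMem d v).mem i = if i = d then v else s.mem i := by
  simp [State.setMem, Function.update_apply]

@[simp] theorem State.setMem_reg (s : State) (d v : ℕ) : (s.setMem d v).reg = s.reg := rfl

/-- Arithmetic expressions over twenty variables and an input sequence. -/
inductive Expr : Type
  | const (v : ℕ) : Expr
  | var (i : Fin 20) : Expr
  | add (a b : Expr) : Expr
  | sub (a b : Expr) : Expr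
  | half (a : Expr) : Expr
  | mul (a : Expr) (i : Fin 20) : Expr
  | inp (a : Expr) : Expr

namespace Expr

@[simp] def eval (l : ℕ → ℕ) (ρ : Fin 20 → ℕ) : Expr → ℕ
  | const v => v
  | var i => ρ i
  | add a b => a.eval l ρ + b.eval l ρ
  | sub a b => a.eval l ρ - b.eval l ρ
  | half a => a.eval l ρ / 2
  | mul a i => a.eval l ρ * ρ i
  | inp a => l (a.eval l ρ)

/-- A program that computes the value of an expression in register `d`. The variables are in the
registers below `20`, and register `1` holds the length of the input in the memory. -/
def comp : Expr → ℕ → Prog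
  | const v, d => .const d v
  | var i, d => .seq (.const d 0) (.add d d i)
  | add a b, d => .seq (a.comp d) (.seq (b.comp (d + 1)) (.add d d (d + 1)))
  | sub a b, d => .seq (a.comp d) (.seq (b.comp (d + 1)) (.sub d d (d + 1)))
  | half a, d => .seq (a.comp d) (.half d d)
  | mul a i, d => .seq (a.comp d) (.seq (.const (d + 1) 0) (.seq (.const (d + 2) 0)
      (.seq (.add (d + 2) (d + 2) i) (.seq (.const (d + 3) 1)
      (.seq (.loop (d + 2) (.seq (.sub (d + 2) (d + 2) (d + 3)) (.add (d + 1) (d + 1) d)))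
      (.seq (.const d 0) (.add d d (d + 1))))))))
  | inp a, d => .seq (a.comp d) (.seq (.const (d + 1) 0) (.seq (.add (d + 1) (d + 1) 1)
      (.seq (.sub (d + 1) (d + 1) d) (.cond (d + 1) (.load d d) (.const d 0)))))

end Expr

/-- The state holds the variables `ρ`, bounded by `N`, and the input `l` of length `ρ 1`. -/
structure Env (s : State) (l : ℕ → ℕ) (ρ : Fin 20 → ℕ) (N : ℕ) : Prop where
  reg : ∀ i : Fin 20, s.reg i = ρ i
  le : ∀ i, ρ i ≤ N
  low : ∀ a < ρ 1, s.mem a = l a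
  high : ∀ a, ρ 1 ≤ a → l a = 0

/-- Equality of states up to registers with numbers at least `d`. -/
def Agree (d : ℕ) (s s' : State) : Prop := s'.mem = s.mem ∧ ∀ i < d, s'.reg i = s.reg i

theorem Agree.refl (d : ℕ) (s : State) : Agree d s s := ⟨rfl, fun _ _ => rfl⟩

theorem Agree.trans {d : ℕ} {s s₁ s₂ : State} (h : Agree d s s₁) (h' : Agree d s₁ s₂) :
    Agree d s s₂ := ⟨h'.1.trans h.1, fun i hi => (h'.2 i hi).trans (h.2 i hi)⟩

theorem Agree.mono {d d' : ℕ} {s s' : State} (h : Agree d s s') (hd : d' ≤ d) : Agree d' s s' :=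
  ⟨h.1, fun i hi => h.2 i (by omega)⟩

theorem Agree.setReg {d : ℕ} (s : State) {e : ℕ} (v : ℕ) (h : d ≤ e) : Agree d s (s.setReg e v) :=
  ⟨rfl, fun i hi => by rw [State.setReg_reg, if_neg (by omega)]⟩

theorem Env.congr {s s' : State} {l : ℕ → ℕ} {ρ : Fin 20 → ℕ} {N d : ℕ} (h : Env s l ρ N)
    (hs : Agree d s s') (hd : 20 ≤ d) : Env s' l ρ N :=
  ⟨fun i => (hs.2 i (by omega)).trans (h.reg i), h.le, fun a ha => by rw [hs.1, h.low a ha], h.high⟩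

/-- A product is computed by repeated addition; its second factor is a variable, so the number of
rounds is at most `N`. Reads are guarded by the input length, because the cells behind the input
hold the set of facts. -/
theorem Expr.exists_runs (e : Expr) : ∃ p : Polynomial ℕ, ∀ d, 20 ≤ d → ∀ s l ρ N, Env s l ρ N →
    ∃ s', Runs (e.comp d) (p.eval N) s s' ∧ Agree d s s' ∧ s'.reg d = e.eval l ρ := by
  induction e with
  | const v =>
    exact ⟨1, fun d _ s l ρ N _ => ⟨_, (Exec.const s d v).runs.mono (by simp),
      .setReg s v le_rfl, by simp⟩⟩
  | var i =>
    refine ⟨2, fun d hd s l ρ N h => ⟨_, ((Exec.const s d 0).runs.seq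
      (Exec.add _ d d i).runs).mono (by simp), (Agree.setReg _ _ le_rfl).trans
        (.setReg _ _ le_rfl), ?_⟩⟩
    have : (i : ℕ) ≠ d := by omega
    simp [this, h.reg]
  | add a b iha ihb =>
    obtain ⟨pa, ha⟩ := iha
    obtain ⟨pb, hb⟩ := ihb
    refine ⟨pa + (pb + 1), fun d hd s l ρ N h => ?_⟩
    obtain ⟨s₁, r₁, g₁, v₁⟩ := ha d hd s l ρ N h
    obtain ⟨s₂, r₂, g₂, v₂⟩ := hb (d + 1) (by omega) s₁ l ρ N (h.congr g₁ hd)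
    refine ⟨_, (r₁.seq (r₂.seq (Exec.add _ d d (d + 1)).runs)).mono (by simp),
      (g₁.trans (g₂.mono (by omega))).trans (.setReg _ _ le_rfl), ?_⟩
    simp [v₂, g₂.2 d (by omega), v₁]
  | sub a b iha ihb =>
    obtain ⟨pa, ha⟩ := iha
    obtain ⟨pb, hb⟩ := ihb
    refine ⟨pa + (pb + 1), fun d hd s l ρ N h => ?_⟩
    obtain ⟨s₁, r₁, g₁, v₁⟩ := ha d hd s l ρ N h
    obtain ⟨s₂, r₂, g₂, v₂⟩ := hb (d + 1) (by omega) s₁ l ρ N (h.congr g₁ hd)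
    refine ⟨_, (r₁.seq (r₂.seq (Exec.sub _ d d (d + 1)).runs)).mono (by simp),
      (g₁.trans (g₂.mono (by omega))).trans (.setReg _ _ le_rfl), ?_⟩
    simp [v₂, g₂.2 d (by omega), v₁]
  | half a iha =>
    obtain ⟨pa, ha⟩ := iha
    refine ⟨pa + 1, fun d hd s l ρ N h => ?_⟩
    obtain ⟨s₁, r₁, g₁, v₁⟩ := ha d hd s l ρ N h
    exact ⟨_, (r₁.seq (Exec.half _ d d).runs).mono (by simp), g₁.trans (.setReg _ _ le_rfl),
      by simp [v₁]⟩
  | mul a i iha =>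
    obtain ⟨pa, ha⟩ := iha
    refine ⟨pa + (Polynomial.X * 3 + 7), fun d hd s l ρ N h => ?_⟩
    obtain ⟨s₁, r₁, g₁, v₁⟩ := ha d hd s l ρ N h
    have hi : ∀ j, d ≤ j → (i : ℕ) ≠ j := fun j hj => by omega
    have r₂ := (Exec.const s₁ (d + 1) 0).runs
    have r₃ := (Exec.const (s₁.setReg (d + 1) 0) (d + 2) 0).runs
    have r₄ := (Exec.add ((s₁.setReg (d + 1) 0).setReg (d + 2) 0) (d + 2) (d + 2) i).runs
    have r₅ := (Exec.const (((s₁.setReg (d + 1) 0).setReg (d + 2) 0).setReg (d + 2)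
      ((((s₁.setReg (d + 1) 0).setReg (d + 2) 0)).reg (d + 2) +
        ((s₁.setReg (d + 1) 0).setReg (d + 2) 0).reg i)) (d + 3) 1).runs
    generalize hs₅ : State.setReg _ (d + 3) 1 = s₅ at r₅
    have g₅ : Agree (d + 1) s₁ s₅ := by
      rw [← hs₅]
      exact (((Agree.setReg _ _ (by omega)).trans (.setReg _ _ (by omega))).trans
        (.setReg _ _ (by omega))).trans (.setReg _ _ (by omega))
    -- Invariant: the accumulator plus the remaining rounds times the first factor is the product.
    obtain ⟨s₆, r₆, n₆, g₆, v₆, -⟩ := runs_loop (a := d + 2) (T := 2)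
      (P := .seq (.sub (d + 2) (d + 2) (d + 3)) (.add (d + 1) (d + 1) d))
      (fun n s' => s'.reg (d + 2) = n ∧ Agree (d + 1) s₁ s' ∧
        s'.reg (d + 1) + n * a.eval l ρ = a.eval l ρ * ρ i ∧ s'.reg (d + 3) = 1)
      (fun n s' h => h.1)
      (fun n s' ⟨h1, h2, h3, h4⟩ => by
        refine ⟨_, (Exec.sub s' _ _ _).runs.seq (Exec.add _ _ _ _).runs, ?_, ?_, ?_, ?_⟩
        · simp [h1, h4]
        · exact (h2.trans (.setReg _ _ (by omega))).trans (.setReg _ _ le_rfl)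
        · simp only [State.setReg_reg]
          rw [if_pos trivial, if_neg (by omega), if_neg (by omega), h2.2 d (by omega), v₁, ← h3]
          ring
        · simpa using h4) (ρ i) s₅ (by
          have hii := (g₁.2 i (by omega)).trans (h.reg i)
          refine ⟨?_, g₅, ?_, ?_⟩ <;> rw [← hs₅]
          · simp [hi, hii]
          · simp; ring
          · simp)
    refine ⟨_, (r₁.seq (r₂.seq (r₃.seq (r₄.seq (r₅.seq (r₆.seq ((Exec.const s₆ d 0).runs.seq
      (Exec.add _ d d (d + 1)).runs))))))).mono ?_, (g₁.trans (g₆.mono (by omega))).trans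
      ((Agree.setReg _ _ le_rfl).trans (.setReg _ _ le_rfl)), ?_⟩
    · have := h.le i
      simp
      omega
    · have : s₆.reg (d + 1) = a.eval l ρ * ρ i := by simpa using v₆
      simp [this]
  | inp a iha =>
    obtain ⟨pa, ha⟩ := iha
    refine ⟨pa + 5, fun d hd s l ρ N h => ?_⟩
    obtain ⟨s₁, r₁, g₁, v₁⟩ := ha d hd s l ρ N h
    have h1 : s₁.reg 1 = ρ 1 := (h.congr g₁ hd).reg 1
    have r₂ := (Exec.const s₁ (d + 1) 0).runs
    have r₃ := (Exec.add (s₁.setReg (d + 1) 0) (d + 1) (d + 1) 1).runs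
    have r₄ := (Exec.sub ((s₁.setReg (d + 1) 0).setReg (d + 1)
      ((s₁.setReg (d + 1) 0).reg (d + 1) + (s₁.setReg (d + 1) 0).reg 1)) (d + 1) (d + 1) d).runs
    generalize hs₄ : State.setReg _ (d + 1) (_ - _) = s₄ at r₄
    have g₄ : Agree (d + 1) s₁ s₄ := by
      rw [← hs₄]
      exact ((Agree.setReg _ _ le_rfl).trans (.setReg _ _ le_rfl)).trans (.setReg _ _ le_rfl)
    have hd4 : s₄.reg d = a.eval l ρ := (g₄.2 d (by omega)).trans v₁
    have hd41 : s₄.reg (d + 1) = ρ 1 - a.eval l ρ := by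
      rw [← hs₄]
      have : d ≠ 0 := by omega
      simp [h1, v₁, this]
    have g := g₁.trans (g₄.mono (by omega))
    by_cases hlt : a.eval l ρ < ρ 1
    · refine ⟨_, (r₁.seq (r₂.seq (r₃.seq (r₄.seq (.cond_true (by omega)
        (Exec.load s₄ d d).runs))))).mono (by simp), g.trans (.setReg _ _ le_rfl), ?_⟩
      simp [hd4, g.1, h.low _ hlt]
    · refine ⟨_, (r₁.seq (r₂.seq (r₃.seq (r₄.seq (.cond_false (by omega)
        (Exec.const s₄ d 0).runs))))).mono (by simp), g.trans (.setReg _ _ le_rfl), ?_⟩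
      simp [h.high _ (not_lt.mp hlt)]

/-! ### Assignments to variables. -/

/-- Assignment of the value of an expression to a variable. -/
def assign (i : Fin 20) (e : Expr) : Prog := .seq (e.comp 21) (.seq (.const 22 0) (.add i 21 22))

theorem exists_runs_assign (i : Fin 20) (e : Expr) : ∃ p : Polynomial ℕ, ∀ s l ρ N, Env s l ρ N →
    ∃ s', Runs (assign i e) (p.eval N) s s' ∧ s'.mem = s.mem ∧
      ∀ j : Fin 20, s'.reg j = Function.update ρ i (e.eval l ρ) j := by
  obtain ⟨p, hp⟩ := e.exists_runs
  refine ⟨p + 2, fun s l ρ N h => ?_⟩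
  obtain ⟨s₁, r₁, g₁, v₁⟩ := hp 21 (by omega) s l ρ N h
  refine ⟨_, (r₁.seq ((Exec.const s₁ 22 0).runs.seq (Exec.add _ i 21 22).runs)).mono (by simp),
    g₁.1, fun j => ?_⟩
  have hj : (j : ℕ) ≠ 22 := by omega
  have := (h.congr g₁ (by omega)).reg j
  simp only [State.setReg_reg, Function.update_apply, Fin.ext_iff]
  split_ifs <;> simp_all

/-- Consecutive assignments. -/
def assigns : List (Fin 20 × Expr) → Prog
  | [] => .const 21 0
  | (i, e) :: as => .seq (assign i e) (assigns as)

def assignsEnv (l : ℕ → ℕ) : List (Fin 20 × Expr) → (Fin 20 → ℕ) → Fin 20 → ℕ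
  | [], ρ => ρ
  | (i, e) :: as, ρ => assignsEnv l as (Function.update ρ i (e.eval l ρ))

/-- Variable `1` is excluded because it delimits the input; changing it would change the meaning of
the memory. -/
def AssignsLe (l : ℕ → ℕ) (N : ℕ) : List (Fin 20 × Expr) → (Fin 20 → ℕ) → Prop
  | [], _ => True
  | (i, e) :: as, ρ =>
      i ≠ 1 ∧ e.eval l ρ ≤ N ∧ AssignsLe l N as (Function.update ρ i (e.eval l ρ))

theorem Env.update {s s' : State} {l : ℕ → ℕ} {ρ : Fin 20 → ℕ} {N : ℕ} {i : Fin 20} {v : ℕ}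
    (h : Env s l ρ N) (hi : i ≠ 1) (hv : v ≤ N) (hmem : s'.mem = s.mem)
    (hreg : ∀ j : Fin 20, s'.reg j = Function.update ρ i v j) :
    Env s' l (Function.update ρ i v) N := by
  have h1 : Function.update ρ i v 1 = ρ 1 := Function.update_of_ne hi.symm _ _
  refine ⟨hreg, fun j => ?_, fun a ha => ?_, fun a ha => ?_⟩
  · rw [Function.update_apply]; split_ifs
    exacts [hv, h.le j]
  · rw [h1] at ha; rw [hmem, h.low a ha]
  · rw [h1] at ha; exact h.high a ha

theorem exists_runs_assigns (as : List (Fin 20 × Expr)) : ∃ p : Polynomial ℕ, ∀ s l ρ N,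
    Env s l ρ N → AssignsLe l N as ρ → ∃ s', Runs (assigns as) (p.eval N) s s' ∧
      s'.mem = s.mem ∧ Env s' l (assignsEnv l as ρ) N := by
  induction as with
  | nil =>
    exact ⟨1, fun s l ρ N h _ => ⟨_, (Exec.const s 21 0).runs.mono (by simp), rfl,
      h.congr (.setReg s 0 le_rfl) (by omega)⟩⟩
  | cons a as ih =>
    obtain ⟨i, e⟩ := a
    obtain ⟨p, hp⟩ := exists_runs_assign i e
    obtain ⟨q, hq⟩ := ih
    refine ⟨p + q, fun s l ρ N h hle => ?_⟩
    obtain ⟨s₁, r₁, m₁, g₁⟩ := hp s l ρ N h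
    obtain ⟨s₂, r₂, m₂, h₂⟩ := hq s₁ l _ N (h.update hle.1 hle.2.1 m₁ g₁) hle.2.2
    exact ⟨s₂, (r₁.seq r₂).mono (by simp), m₂.trans m₁, h₂⟩

/-! ### Saturation under Horn clauses -/

/-- The state holds the variables `ρ`, the input `l`, and after the input the set `X`. -/
structure Rep (s : State) (l : ℕ → ℕ) (ρ : Fin 20 → ℕ) (N : ℕ) (X : Set ℕ) : Prop
    extends Env s l ρ N where
  mem_iff : ∀ a, s.mem (ρ 1 + a) ≠ 0 ↔ a ∈ X

theorem Rep.congr {s s' : State} {l : ℕ → ℕ} {ρ : Fin 20 → ℕ} {N d : ℕ} {X : Set ℕ}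
    (h : Rep s l ρ N X) (hs : Agree d s s') (hd : 20 ≤ d) : Rep s' l ρ N X :=
  ⟨h.toEnv.congr hs hd, fun a => by rw [hs.1, h.mem_iff]⟩

theorem Rep.update {s s' : State} {l : ℕ → ℕ} {ρ : Fin 20 → ℕ} {N : ℕ} {X : Set ℕ} {i : Fin 20}
    {v : ℕ} (h : Rep s l ρ N X) (hi : i ≠ 1) (hv : v ≤ N) (hmem : s'.mem = s.mem)
    (hreg : ∀ j : Fin 20, s'.reg j = Function.update ρ i v j) :
    Rep s' l (Function.update ρ i v) N X :=
  ⟨h.toEnv.update hi hv hmem hreg, fun a => by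
    rw [hmem, Function.update_of_ne hi.symm, h.mem_iff]⟩

/-- Premises of a Horn clause: an expression has a nonzero value, or it is in the current set. -/
inductive Test : Type
  | val (e : Expr) : Test
  | fact (e : Expr) : Test

def Test.Holds (l : ℕ → ℕ) (ρ : Fin 20 → ℕ) (X : Set ℕ) : Test → Prop
  | val e => e.eval l ρ ≠ 0
  | fact e => e.eval l ρ ∈ X

@[simp] theorem Test.holds_val {l : ℕ → ℕ} {ρ : Fin 20 → ℕ} {X : Set ℕ} {e : Expr} :
    (val e).Holds l ρ X ↔ e.eval l ρ ≠ 0 := Iff.rfl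

@[simp] theorem Test.holds_fact {l : ℕ → ℕ} {ρ : Fin 20 → ℕ} {X : Set ℕ} {e : Expr} :
    (fact e).Holds l ρ X ↔ e.eval l ρ ∈ X := Iff.rfl

def Test.comp : Test → Prog
  | val e => e.comp 21
  | fact e => .seq (e.comp 21) (.seq (.add 21 21 1) (.load 21 21))

theorem Test.exists_runs (t : Test) : ∃ p : Polynomial ℕ, ∀ s l ρ N X, Rep s l ρ N X →
    ∃ s', Runs t.comp (p.eval N) s s' ∧ Agree 21 s s' ∧ (s'.reg 21 ≠ 0 ↔ t.Holds l ρ X) := by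
  cases t with
  | val e =>
    obtain ⟨p, hp⟩ := e.exists_runs
    refine ⟨p, fun s l ρ N X h => ?_⟩
    obtain ⟨s₁, r₁, g₁, v₁⟩ := hp 21 (by omega) s l ρ N h.toEnv
    exact ⟨s₁, r₁, g₁, by simp [v₁]⟩
  | fact e =>
    obtain ⟨p, hp⟩ := e.exists_runs
    refine ⟨p + 2, fun s l ρ N X h => ?_⟩
    obtain ⟨s₁, r₁, g₁, v₁⟩ := hp 21 (by omega) s l ρ N h.toEnv
    refine ⟨_, (r₁.seq ((Exec.add s₁ 21 21 1).runs.seq (Exec.load _ 21 21).runs)).mono (by simp),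
      (g₁.trans (.setReg _ _ le_rfl)).trans (.setReg _ _ le_rfl), ?_⟩
    have h1 : s₁.reg 1 = ρ 1 := (h.toEnv.congr g₁ (by omega)).reg 1
    simp only [State.setReg_reg, State.setReg_mem, if_true, v₁, h1, Test.Holds, g₁.1]
    rw [add_comm, h.mem_iff]

/-- Execute a program if all premises hold. -/
def whenAll : List Test → Prog → Prog
  | [], P => P
  | t :: ts, P => .seq t.comp (.cond 21 (whenAll ts P) (.const 21 0))

/-- The state `s₁` is where `P` starts or, if a premise fails, where the whole program ends. It is
fixed before anything is assumed about `P`. -/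
theorem exists_runs_whenAll (ts : List Test) : ∃ p : Polynomial ℕ, ∀ P s l ρ N X,
    Rep s l ρ N X → ∃ s₁, Agree 21 s s₁ ∧
      ((∀ t ∈ ts, t.Holds l ρ X) → ∀ T s', Runs P T s₁ s' →
        Runs (whenAll ts P) (p.eval N + T) s s') ∧
      ((¬ ∀ t ∈ ts, t.Holds l ρ X) → Runs (whenAll ts P) (p.eval N) s s₁) := by
  induction ts with
  | nil =>
    exact ⟨0, fun P s l ρ N X _ => ⟨s, .refl _ _, fun _ T s' h => h.mono (by simp), by simp⟩⟩
  | cons t ts ih =>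
    obtain ⟨p, hp⟩ := t.exists_runs
    obtain ⟨q, hq⟩ := ih
    refine ⟨p + (q + 2), fun P s l ρ N X h => ?_⟩
    obtain ⟨s₁, r₁, g₁, v₁⟩ := hp s l ρ N X h
    by_cases ht : t.Holds l ρ X
    · obtain ⟨s₂, g₂, hyes, hno⟩ := hq P s₁ l ρ N X (h.congr g₁ (by omega))
      refine ⟨s₂, g₁.trans g₂, fun hall T s' hr => ?_, fun hnot => ?_⟩
      · exact (r₁.seq (.cond_true (v₁.mpr ht) (hyes (fun t ht => hall t (by simp [ht])) T s' hr))).mono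
          (by simp only [Polynomial.eval_add, Polynomial.eval_ofNat]; omega)
      · exact (r₁.seq (.cond_true (v₁.mpr ht) (hno fun hall => hnot (by simpa [ht] using hall)))).mono
          (by simp only [Polynomial.eval_add, Polynomial.eval_ofNat]; omega)
    · refine ⟨_, g₁.trans (.setReg _ 0 le_rfl), fun hall => absurd (hall t (by simp)) ht, fun _ =>
        (r₁.seq (.cond_false (by simpa using (not_congr v₁).mpr ht)
          (Exec.const s₁ 21 0).runs)).mono
          (by simp only [Polynomial.eval_add, Polynomial.eval_ofNat]; omega)⟩

/-! ### Passes through the rules, with sets updated in place. -/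

/-- One round of applications of the clauses `G` leads from `X` to `X'`. -/
def Pass (G : Set ℕ → ℕ → Prop) (X X' : Set ℕ) : Prop :=
  X ⊆ X' ∧ (∀ y, G X y → y ∈ X') ∧ ∀ D, X ⊆ D → (∀ y, G D y → y ∈ D) → X' ⊆ D

/-- Systems of clauses that depend on the input and the variables. -/
abbrev Clauses := (ℕ → ℕ) → (Fin 20 → ℕ) → Set ℕ → ℕ → Prop

def Clauses.Mono (F : Clauses) : Prop :=
  ∀ l ρ X X' y, X ⊆ X' → F l ρ X y → F l ρ X' y

/-- In polynomial time, the program applies the clauses `F` to the set in the memory. -/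
def Applies (P : Prog) (ok : (Fin 20 → ℕ) → Prop) (F : Clauses) : Prop :=
  ∃ p : Polynomial ℕ, ∀ s l ρ N X, ok ρ → Rep s l ρ N X →
    ∃ s' X', Runs P (p.eval N) s s' ∧ s'.reg 20 = s.reg 20 ∧ Rep s' l ρ N X' ∧ Pass (F l ρ) X X'

/-- A Horn clause with premises `tests` and conclusion `concl`, for all values of the variables
`vars`, each of which ranges over the numbers below the value of another variable. -/
structure Clause : Type where
  vars : List (Fin 20 × Fin 20)
  tests : List Test
  concl : Expr

def Clause.body (r : Clause) : Prog :=
  whenAll r.tests (.seq (r.concl.comp 21) (.seq (.add 21 21 1) (.seq (.const 22 1) (.store 21 22))))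

def Clause.ground (r : Clause) : Clauses := fun l ρ X y =>
  (∀ t ∈ r.tests, t.Holds l ρ X) ∧ r.concl.eval l ρ = y

theorem Test.Holds.mono {l : ℕ → ℕ} {ρ : Fin 20 → ℕ} {X X' : Set ℕ} (hX : X ⊆ X') {t : Test}
    (h : t.Holds l ρ X) : t.Holds l ρ X' := by
  cases t with
  | val e => exact h
  | fact e => exact hX h

theorem Clause.mono_ground (r : Clause) : r.ground.Mono :=
  fun _ _ _ _ _ hX h => ⟨fun t ht => (h.1 t ht).mono hX, h.2⟩

theorem Clause.applies_body (r : Clause) : Applies r.body (fun _ => True) r.ground := by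
  obtain ⟨p, hp⟩ := exists_runs_whenAll r.tests
  obtain ⟨q, hq⟩ := r.concl.exists_runs
  refine ⟨p + (q + 3), fun s l ρ N X _ h => ?_⟩
  obtain ⟨s₁, g₁, hyes, hno⟩ := hp (.seq (r.concl.comp 21) (.seq (.add 21 21 1)
    (.seq (.const 22 1) (.store 21 22)))) s l ρ N X h
  have h₁ := h.congr g₁ (by omega)
  by_cases hall : ∀ t ∈ r.tests, t.Holds l ρ X
  · obtain ⟨s₂, r₂, g₂, v₂⟩ := hq 21 (by omega) s₁ l ρ N h₁.toEnv
    have h₂ := h₁.congr g₂ (by omega)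
    have h1 : s₂.reg 1 = ρ 1 := h₂.reg 1
    have hg : Agree 21 s s₂ := g₁.trans g₂
    refine ⟨_, insert (r.concl.eval l ρ) X, (hyes hall _ _ (r₂.seq ((Exec.add s₂ 21 21 1).runs.seq
      ((Exec.const _ 22 1).runs.seq (Exec.store _ 21 22).runs)))).mono (by simp), ?_,
      ⟨⟨fun i => ?_, h.le, fun a ha => ?_, h.high⟩, fun a => ?_⟩, Set.subset_insert _ _, ?_, ?_⟩
    · simpa using hg.2 20 (by omega)
    · have e1 : (i : ℕ) ≠ 21 := by omega
      have e2 : (i : ℕ) ≠ 22 := by omega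
      simp [e1, e2, h₂.reg i]
    · simp only [State.setMem_mem, State.setReg_mem, State.setReg_reg]
      rw [if_neg (by simp [h1]; omega)]
      exact h₂.low a ha
    · simp only [State.setMem_mem, State.setReg_mem, State.setReg_reg, Set.mem_insert_iff]
      rw [← h₂.mem_iff]
      by_cases ha : a = r.concl.eval l ρ <;> simp [v₂, h1, add_comm (ρ 1), ha]
    · exact fun y hy => .inl hy.2.symm
    · intro D hXD hD
      refine Set.insert_subset (hD _ ⟨fun t ht => (hall t ht).mono hXD, rfl⟩) hXD
  · refine ⟨s₁, X, (hno hall).mono (by simp), g₁.2 20 (by omega), h₁, subset_rfl,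
      fun y hy => absurd hy.1 hall, fun D h _ => h⟩

/-- Repetition of a program for all values of `x` below the value of `b`, in descending order. -/
def forLoop (x b : Fin 20) (P : Prog) : Prog :=
  .seq (.const 21 0) (.seq (.add x b 21) (.loop x (.seq (.const 21 1) (.seq (.sub x x 21) P))))

theorem Rep.setVar {s : State} {l : ℕ → ℕ} {ρ : Fin 20 → ℕ} {N : ℕ} {X : Set ℕ} {x : Fin 20}
    {m : ℕ} (h : Rep s l (Function.update ρ x m) N X) (hx : x ≠ 1) {v w : ℕ} (hv : v ≤ N) :
    Rep ((s.setReg 21 w).setReg x v) l (Function.update ρ x v) N X := by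
  have := h.update (s' := (s.setReg 21 w).setReg x v) (v := v) hx hv rfl fun j => by
    have : (j : ℕ) ≠ 21 := by omega
    simp only [State.setReg_reg, this, if_false, h.reg, Function.update_idem]
    simp only [Function.update_apply, Fin.ext_iff]
    split_ifs <;> rfl
  rwa [Function.update_idem] at this

/-- The loop variable is zero before and after, so the environment is restored. The invariant also
sees register `20`, which counts the passes in `saturate` and the successes in `countProg`. -/
theorem exists_runs_forLoop {x b : Fin 20} {P : Prog} {l : ℕ → ℕ} {ρ : Fin 20 → ℕ} {N T : ℕ}
    (hx : x ≠ 1) (hρ : ρ x = 0) (I : ℕ → ℕ → Set ℕ → Prop)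
    (hP : ∀ n < ρ b, ∀ s X, Rep s l (Function.update ρ x n) N X → I (n + 1) (s.reg 20) X →
      ∃ s' X', Runs P T s s' ∧ Rep s' l (Function.update ρ x n) N X' ∧ I n (s'.reg 20) X')
    {s : State} {X : Set ℕ} (h : Rep s l ρ N X) (hI : I (ρ b) (s.reg 20) X) :
    ∃ s' X', Runs (forLoop x b P) (N * (T + 3) + 3) s s' ∧ Rep s' l ρ N X' ∧
      I 0 (s'.reg 20) X' := by
  have hb := h.le b
  have h20 : ∀ (s : State) (v w : ℕ), ((s.setReg 21 w).setReg x v).reg 20 = s.reg 20 := by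
    intro s v w
    have : 20 ≠ (x : ℕ) := by omega
    simp [this]
  have hx21 : (x : ℕ) ≠ 21 := by omega
  have hb21 : (b : ℕ) ≠ 21 := by omega
  have h0 : Rep s l (Function.update ρ x 0) N X := by rwa [← hρ, Function.update_eq_self]
  obtain ⟨s', r, -, X', h', hI'⟩ := runs_loop (a := x) (T := T + 2)
    (P := .seq (.const 21 1) (.seq (.sub x x 21) P))
    (fun n s => n ≤ ρ b ∧ ∃ X, Rep s l (Function.update ρ x n) N X ∧ I n (s.reg 20) X)
    (fun n s ⟨_, X, hs, _⟩ => by rw [hs.reg x, Function.update_self])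
    (fun n s ⟨hn, X, hs, hIs⟩ => by
      have hxn : s.reg x = n + 1 := by rw [hs.reg x, Function.update_self]
      obtain ⟨s', X', r, h', hI'⟩ := hP n (by omega) ((s.setReg 21 1).setReg x n) X
        (hs.setVar hx (by omega)) (by rwa [h20])
      refine ⟨s', ((Exec.const s 21 1).runs.seq ((Exec.sub _ x x 21).runs.seq
        (by simpa [hx21, hxn] using r))).mono (by omega), by omega, X', h', hI'⟩)
    (ρ b) ((s.setReg 21 0).setReg x (ρ b))
    ⟨le_rfl, X, h0.setVar hx hb, by rwa [h20]⟩
  rw [← hρ, Function.update_eq_self] at h'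
  refine ⟨s', X', ((Exec.const s 21 0).runs.seq ((Exec.add _ x b 21).runs.seq
    (by simpa [hb21, h.reg] using r))).mono ?_, h', hI'⟩
  have := Nat.mul_le_mul_right (T + 3) hb
  rw [show T + 2 + 1 = T + 3 from rfl]
  omega

/-- Later instances already see the facts added by earlier ones. Monotonicity shows that no
conclusion from the initial set is lost, and a set closed under all instances still bounds the
result. -/
theorem Applies.forLoop {P : Prog} {ok : (Fin 20 → ℕ) → Prop} {F : Clauses} (hP : Applies P ok F)
    (hF : F.Mono) {x b : Fin 20} (hx : x ≠ 1) :
    Applies (forLoop x b P) (fun ρ => ρ x = 0 ∧ ∀ n < ρ b, ok (Function.update ρ x n))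
      (fun l ρ X y => ∃ n < ρ b, F l (Function.update ρ x n) X y) := by
  obtain ⟨p, hp⟩ := hP
  refine ⟨Polynomial.X * (p + 3) + 3, fun s l ρ N X hok h => ?_⟩
  obtain ⟨s', X', r, h', e, h1, h2, h3⟩ := exists_runs_forLoop (b := b) (P := P) (T := p.eval N) hx
    hok.1 (fun n c X' => c = s.reg 20 ∧ X ⊆ X' ∧
      (∀ m, n ≤ m → m < ρ b → ∀ y, F l (Function.update ρ x m) X y → y ∈ X') ∧
      ∀ D, X ⊆ D → (∀ y, (∃ n < ρ b, F l (Function.update ρ x n) D y) → y ∈ D) → X' ⊆ D)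
    (fun n hn s₁ X₁ hs₁ ⟨e, h1, h2, h3⟩ => by
      obtain ⟨s₂, X₂, r, e', h', g1, g2, g3⟩ := hp s₁ l _ N X₁ (hok.2 n hn) hs₁
      refine ⟨s₂, X₂, r, h', e'.trans e, h1.trans g1, fun m hnm hm y hy => ?_, fun D hXD hD => ?_⟩
      · rcases hnm.lt_or_eq with hlt | rfl
        · exact g1 (h2 m hlt hm y hy)
        · exact g2 y (hF _ _ _ _ _ h1 hy)
      · exact g3 D (h3 D hXD hD) fun y hy => hD y ⟨n, hn, hy⟩)
    h ⟨rfl, subset_rfl, fun m h h' => by omega, fun D h _ => h⟩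
  refine ⟨s', X', r.mono (by simp), e, h', h1, ?_, h3⟩
  rintro y ⟨n, hn, hy⟩
  exact h2 n (Nat.zero_le n) hn y hy

theorem Applies.seq {P P' : Prog} {ok : (Fin 20 → ℕ) → Prop} {F F' : Clauses}
    (h : Applies P ok F) (h' : Applies P' ok F') (hF' : F'.Mono) :
    Applies (.seq P P') ok (fun l ρ X y => F l ρ X y ∨ F' l ρ X y) := by
  obtain ⟨p, hp⟩ := h
  obtain ⟨q, hq⟩ := h'
  refine ⟨p + q, fun s l ρ N X hok h => ?_⟩
  obtain ⟨s₁, X₁, r₁, e₁, h₁, a1, a2, a3⟩ := hp s l ρ N X hok h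
  obtain ⟨s₂, X₂, r₂, e₂, h₂, b1, b2, b3⟩ := hq s₁ l ρ N X₁ hok h₁
  refine ⟨s₂, X₂, (r₁.seq r₂).mono (by simp), e₂.trans e₁, h₂, a1.trans b1, ?_, fun D hXD hD => ?_⟩
  · rintro y (hy | hy)
    · exact b1 (a2 y hy)
    · exact b2 y (hF' _ _ _ _ _ a1 hy)
  · exact b3 D (a3 D hXD fun y hy => hD y (.inl hy)) fun y hy => hD y (.inr hy)

def nest : List (Fin 20 × Fin 20) → Prog → Prog
  | [], P => P
  | (x, b) :: vs, P => forLoop x b (nest vs P)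

def Clauses.inst (F : Clauses) : List (Fin 20 × Fin 20) → Clauses
  | [] => F
  | (x, b) :: vs => fun l ρ X y => ∃ n < ρ b, F.inst vs l (Function.update ρ x n) X y

theorem Clauses.Mono.inst {F : Clauses} (hF : F.Mono) (vs : List (Fin 20 × Fin 20)) :
    (F.inst vs).Mono := by
  induction vs with
  | nil => exact hF
  | cons v vs ih =>
    rintro l ρ X X' y hX ⟨n, hn, h⟩
    exact ⟨n, hn, ih _ _ _ _ _ hX h⟩

theorem Applies.mono_ok {P : Prog} {ok ok' : (Fin 20 → ℕ) → Prop} {F : Clauses}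
    (h : Applies P ok F) (hok : ∀ ρ, ok' ρ → ok ρ) : Applies P ok' F :=
  h.imp fun _ hp s l ρ N X h => hp s l ρ N X (hok ρ h)

/-- Each loop needs its variable to be zero at the start; distinctness keeps the inner variables
zero when an outer one is set. -/
theorem Applies.nest {P : Prog} {F : Clauses} (hP : Applies P (fun _ => True) F) (hF : F.Mono)
    (vs : List (Fin 20 × Fin 20)) (hvs : (vs.map Prod.fst).Nodup) (h1 : 1 ∉ vs.map Prod.fst) :
    Applies (nest vs P) (fun ρ => ∀ x ∈ vs.map Prod.fst, ρ x = 0) (F.inst vs) := by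
  induction vs with
  | nil => exact hP.mono_ok fun _ _ => trivial
  | cons v vs ih =>
    obtain ⟨x, b⟩ := v
    simp only [List.map_cons, List.nodup_cons, List.mem_cons, not_or] at hvs h1
    refine ((ih hvs.2 h1.2).forLoop (hF.inst vs) (Ne.symm h1.1)).mono_ok fun ρ hρ => ?_
    refine ⟨hρ x (by simp), fun n _ y hy => ?_⟩
    rw [Function.update_of_ne (by rintro rfl; exact hvs.1 hy)]
    exact hρ y (by rw [List.map_cons]; exact List.mem_cons_of_mem _ hy)

def Clause.prog (r : Clause) : Prog := nest r.vars r.body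

def Clause.clauses (r : Clause) : Clauses := r.ground.inst r.vars

/-- The variables of a clause are distinct and among the last nine variables. -/
def Clause.WF (r : Clause) : Prop :=
  (r.vars.map Prod.fst).Nodup ∧ ∀ x ∈ r.vars.map Prod.fst, (11 : Fin 20) ≤ x

def passProg (rs : List Clause) : Prog := rs.foldr (fun r P => .seq r.prog P) (.const 21 0)

theorem applies_passProg (rs : List Clause) (hrs : ∀ r ∈ rs, r.WF) :
    Applies (passProg rs) (fun ρ => ∀ x, 11 ≤ x → ρ x = 0)
      (fun l ρ X y => ∃ r ∈ rs, r.clauses l ρ X y) := by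
  induction rs with
  | nil =>
    refine ⟨1, fun s l ρ N X _ h => ⟨_, X, (Exec.const s 21 0).runs.mono (by simp), by simp,
      h.congr (.setReg s 0 le_rfl) (by omega), subset_rfl, by simp, fun D h _ => h⟩⟩
  | cons r rs ih =>
    have hr := hrs r (by simp)
    have := ((r.applies_body.nest r.mono_ground r.vars hr.1 fun h =>
      absurd (hr.2 1 h) (by decide)).mono_ok fun ρ hρ x hx => hρ x (hr.2 x hx)).seq
      (ih fun r hr => hrs r (by simp [hr])) fun l ρ X X' y hX ⟨r, hr, h⟩ =>
        ⟨r, hr, r.mono_ground.inst r.vars _ _ _ _ _ hX h⟩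
    simp only [List.mem_cons, exists_eq_or_imp]
    exact this

/-- `X` results from `m` passes, beginning with the empty set. -/
inductive Passes (G : Set ℕ → ℕ → Prop) : ℕ → Set ℕ → Prop
  | zero : Passes G 0 ∅
  | succ {m : ℕ} {X X' : Set ℕ} : Passes G m X → Pass G X X' → Passes G (m + 1) X'

theorem Passes.least {G : Set ℕ → ℕ → Prop} {m : ℕ} {X : Set ℕ} (h : Passes G m X) {D : Set ℕ}
    (hD : ∀ y, G D y → y ∈ D) : X ⊆ D := by
  induction h with
  | zero => exact Set.empty_subset D
  | succ _ hp ih => exact hp.2.2 D ih hD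

/-- A pass either enlarges the set or shows that it is closed. All sets stay inside the finite `D`,
so fewer than `m` enlargements are possible. -/
theorem Passes.closed {G : Set ℕ → ℕ → Prop} {m : ℕ} {X : Set ℕ} (h : Passes G m X) {D : Set ℕ}
    (hD : ∀ y, G D y → y ∈ D) (hfin : D.Finite) (hm : D.ncard < m) : ∀ y, G X y → y ∈ X := by
  have key : (∀ y, G X y → y ∈ X) ∨ m ≤ X.ncard := by
    clear hm
    induction h with
    | zero => simp
    | @succ m X X' h hp ih =>
      rcases ih with ih | ih
      -- A closed set is itself an admissible upper bound for the pass, which therefore adds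
      -- nothing.
      · obtain rfl : X = X' := hp.1.antisymm (hp.2.2 X subset_rfl ih)
        exact .inl ih
      · by_cases heq : X = X'
        · subst heq
          exact .inl hp.2.1
        · have := Set.ncard_lt_ncard (hp.1.ssubset_of_ne heq)
            (hfin.subset ((h.succ hp).least hD))
          exact .inr (by omega)
  refine key.resolve_right fun hle => ?_
  have := Set.ncard_le_ncard (h.least hD) hfin
  omega

/-- Repetition of passes; the number of passes is the value of `b`. -/
def saturate (b : Fin 20) (P : Prog) : Prog :=
  .seq (.const 21 0) (.seq (.add 20 b 21) (.loop 20 (.seq (.const 21 1) (.seq (.sub 20 20 21) P))))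

theorem Applies.saturate {P : Prog} {ok : (Fin 20 → ℕ) → Prop} {F : Clauses} (hP : Applies P ok F)
    (b : Fin 20) : ∃ p : Polynomial ℕ, ∀ s l ρ N, ok ρ → Rep s l ρ N ∅ →
      ∃ s' X, Runs (saturate b P) (p.eval N) s s' ∧ Rep s' l ρ N X ∧ Passes (F l ρ) (ρ b) X := by
  obtain ⟨p, hp⟩ := hP
  refine ⟨Polynomial.X * (p + 3) + 3, fun s l ρ N hok h => ?_⟩
  have hb := h.le b
  have hb21 : (b : ℕ) ≠ 21 := by omega
  have hagree : ∀ (s : State) (v w : ℕ), Agree 20 s ((s.setReg 21 w).setReg 20 v) :=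
    fun s v w => (Agree.setReg s w (by omega)).trans (.setReg _ v le_rfl)
  obtain ⟨s', r, -, -, X, h', hX⟩ := runs_loop (a := 20) (T := p.eval N + 2)
    (P := .seq (.const 21 1) (.seq (.sub 20 20 21) P))
    (fun n s => s.reg 20 = n ∧ n ≤ ρ b ∧ ∃ X, Rep s l ρ N X ∧ Passes (F l ρ) (ρ b - n) X)
    (fun n s h => h.1)
    (fun n s ⟨h20, hn, X, hs, hX⟩ => by
      obtain ⟨s', X', r, e, h', hp⟩ := hp ((s.setReg 21 1).setReg 20 n) l ρ N X hok
        (hs.congr (hagree s n 1) le_rfl)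
      refine ⟨s', ((Exec.const s 21 1).runs.seq ((Exec.sub _ 20 20 21).runs.seq
        (by simpa [h20] using r))).mono (by omega), by simpa using e, by omega, X', h', ?_⟩
      rw [show ρ b - n = ρ b - (n + 1) + 1 by omega]
      exact hX.succ hp)
    (ρ b) ((s.setReg 21 0).setReg 20 (ρ b))
    ⟨by simp, le_rfl, ∅, h.congr (hagree s _ 0) le_rfl, by rw [Nat.sub_self]; exact .zero⟩
  refine ⟨s', X, ((Exec.const s 21 0).runs.seq ((Exec.add _ 20 b 21).runs.seq
    (by simpa [hb21, h.reg] using r))).mono ?_, h', by simpa using hX⟩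
  have := Nat.mul_le_mul_right (p.eval N + 3) hb
  rw [show p.eval N + 2 + 1 = p.eval N + 3 from rfl]
  simp only [Polynomial.eval_add, Polynomial.eval_mul, Polynomial.eval_X, Polynomial.eval_ofNat]
  omega

/-- Compute in register `0` the number of values of `x` below `b` for which the tests hold. -/
def countProg (x b : Fin 20) (ts : List Test) : Prog :=
  .seq (.const 20 0) (.seq (forLoop x b (whenAll ts (.seq (.const 21 1) (.add 20 20 21))))
    (.seq (.const 21 0) (.add 0 20 21)))

open Classical in
theorem exists_runs_countProg (x b : Fin 20) (hx : x ≠ 1) (ts : List Test) :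
    ∃ p : Polynomial ℕ, ∀ s l ρ N X, ρ x = 0 → Rep s l ρ N X →
      ∃ s', Runs (countProg x b ts) (p.eval N) s s' ∧ s'.reg 0 =
        {n ∈ Finset.range (ρ b) | ∀ t ∈ ts, t.Holds l (Function.update ρ x n) X}.card := by
  obtain ⟨p, hp⟩ := exists_runs_whenAll ts
  refine ⟨Polynomial.X * (p + 5) + 6, fun s l ρ N X hρ h => ?_⟩
  -- The loop runs downwards, so `S n` collects the values already tested when `n` remain.
  let S : ℕ → Finset ℕ := fun n =>
    {m ∈ Finset.range (ρ b) | n ≤ m ∧ ∀ t ∈ ts, t.Holds l (Function.update ρ x m) X}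
  obtain ⟨s', X', r, h', hX, hc⟩ := exists_runs_forLoop (b := b)
    (P := whenAll ts (.seq (.const 21 1) (.add 20 20 21))) (T := p.eval N + 2) hx hρ
    (fun n c X' => X' = X ∧ c = (S n).card)
    (fun n hn s₁ X₁ hs₁ ⟨e, hc⟩ => by
      subst e
      obtain ⟨s₂, g₂, hyes, hno⟩ := hp (.seq (.const 21 1) (.add 20 20 21)) s₁ l _ N X₁ hs₁
      have h₂ := hs₁.congr g₂ (by omega)
      have c₂ := (g₂.2 20 (by omega)).trans hc
      by_cases hall : ∀ t ∈ ts, t.Holds l (Function.update ρ x n) X₁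
      · refine ⟨_, X₁, hyes hall 2 _ ((Exec.const s₂ 21 1).runs.seq (Exec.add _ 20 20 21).runs),
          h₂.congr ((Agree.setReg _ _ (by omega)).trans (.setReg _ _ le_rfl)) le_rfl, rfl, ?_⟩
        have : S n = insert n (S (n + 1)) := by
          ext m
          simp only [S, Finset.mem_filter, Finset.mem_range, Finset.mem_insert]
          constructor
          · rintro ⟨h1, h2, h3⟩
            rcases h2.lt_or_eq with h | rfl
            exacts [.inr ⟨h1, h, h3⟩, .inl rfl]
          · rintro (rfl | ⟨h1, h2, h3⟩)
            exacts [⟨hn, le_rfl, hall⟩, ⟨h1, by omega, h3⟩]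
        rw [this, Finset.card_insert_of_notMem (by simp [S])]
        simp [c₂]
      · refine ⟨s₂, X₁, (hno hall).mono (by omega), h₂, rfl, ?_⟩
        rw [c₂]
        congr 1
        ext m
        simp only [S, Finset.mem_filter, Finset.mem_range]
        constructor
        · rintro ⟨h1, h2, h3⟩
          exact ⟨h1, by omega, h3⟩
        · rintro ⟨h1, h2, h3⟩
          refine ⟨h1, ?_, h3⟩
          rcases h2.lt_or_eq with h | rfl
          exacts [h, absurd h3 hall])
    (s := s.setReg 20 0) (X := X) (h.congr (.setReg s 0 le_rfl) le_rfl) ⟨rfl, by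
      have : S (ρ b) = ∅ := by
        ext m
        simp only [S, Finset.mem_filter, Finset.mem_range, Finset.notMem_empty, iff_false]
        omega
      simp [this]⟩
  refine ⟨_, ((Exec.const s 20 0).runs.seq (r.seq ((Exec.const s' 21 0).runs.seq
    (Exec.add _ 0 20 21).runs))).mono (by simp; ring_nf; omega), ?_⟩
  have : S 0 = {n ∈ Finset.range (ρ b) | ∀ t ∈ ts, t.Holds l (Function.update ρ x n) X} := by
    simp only [S, Nat.zero_le, true_and]
  simp [hc, this]

end RAM

/-! ### Reading the description of an automaton -/

theorem getD_append_add (l l' : List ℕ) (k : ℕ) :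
    (l ++ l').getD (l.length + k) 0 = l'.getD k 0 := by
  rw [List.getD_append_right _ _ _ _ (by omega), Nat.add_sub_cancel_left]

theorem length_tableOf {m n : ℕ} (f : Fin m → Fin n → ℕ) : (tableOf f).length = m * n := by
  simp [tableOf]

theorem lt_length_tableOf {m n : ℕ} (f : Fin m → Fin n → ℕ) (i : Fin m) (j : Fin n) :
    (i : ℕ) * n + j < (tableOf f).length := by
  rw [length_tableOf]
  have := (finProdFinEquiv (i, j)).2
  rw [finProdFinEquiv_apply_val] at this
  linarith [mul_comm n (i : ℕ)]

theorem getD_tableOf {m n : ℕ} (f : Fin m → Fin n → ℕ) (i : Fin m) (j : Fin n) :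
    (tableOf f).getD (i * n + j) 0 = f i j := by
  have h := lt_length_tableOf f i j
  have h' : (i : ℕ) * n + j < m * n := length_tableOf f ▸ h
  have e : (⟨i * n + j, h'⟩ : Fin (m * n)) = finProdFinEquiv (i, j) := by
    ext
    simp only [finProdFinEquiv_apply_val]
    ring
  rw [List.getD_eq_getElem _ _ h]
  simp only [tableOf, List.getElem_ofFn, e, Equiv.symm_apply_apply]

theorem getD_ofFn {n : ℕ} (f : Fin n → ℕ) (i : Fin n) : (List.ofFn f).getD i 0 = f i := by
  rw [List.getD_eq_getElem _ _ (by simp)]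
  simp

namespace ParityDVPA

variable {nc ni nr nq ng : ℕ}

section Encode

variable (A : ParityDVPA (Fin nc) (Fin ni) (Fin nr) (Fin nq) (Fin ng))

theorem encode_eq : ∃ L : List ℕ, L.length = 6 ∧ L = [nc, ni, nr, nq, ng, (A.start : ℕ)] ∧
    A.encode = L ++ (List.ofFn A.prio ++ (tableOf (fun q i => (A.δi q i : ℕ)) ++
      (tableOf (fun q c => ((A.δc q c).1 : ℕ)) ++ (tableOf (fun q c => ((A.δc q c).2 : ℕ)) ++
      tableOf (fun (qZ : Fin (nq * ng)) r =>
        (A.δr (finProdFinEquiv.symm qZ).1 (finProdFinEquiv.symm qZ).2 r : ℕ)))))) :=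
  ⟨_, rfl, rfl, by simp only [encode, List.append_assoc]⟩

theorem length_encode : A.encode.length =
    6 + nq + nq * ni + nq * nc + nq * nc + nq * ng * nr := by
  simp [encode, length_tableOf]
  ring

theorem getD_prio (x : Fin nq) : A.encode.getD (6 + x) 0 = A.prio x := by
  obtain ⟨L, hL, -, h⟩ := A.encode_eq
  rw [h, ← hL, getD_append_add, List.getD_append _ _ _ _ (by simp), getD_ofFn]

theorem getD_δi (x : Fin nq) (i : Fin ni) :
    A.encode.getD (6 + nq + (x * ni + i)) 0 = A.δi x i := by
  obtain ⟨L, hL, -, h⟩ := A.encode_eq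
  have e := List.length_ofFn (f := A.prio)
  have e1 := lt_length_tableOf (fun q i => (A.δi q i : ℕ)) x i
  rw [h, show 6 + nq + (x * ni + i) = L.length + ((List.ofFn A.prio).length + (x * ni + i)) by omega,
    getD_append_add, getD_append_add, List.getD_append _ _ _ _ e1, getD_tableOf]

theorem getD_δc_fst (x : Fin nq) (c : Fin nc) :
    A.encode.getD (6 + nq + nq * ni + (x * nc + c)) 0 = (A.δc x c).1 := by
  obtain ⟨L, hL, -, h⟩ := A.encode_eq
  have e := List.length_ofFn (f := A.prio)
  have e1 := length_tableOf (fun q i => (A.δi q i : ℕ))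
  have e2 := lt_length_tableOf (fun q c => ((A.δc q c).1 : ℕ)) x c
  rw [h, show 6 + nq + nq * ni + (x * nc + c) = L.length + ((List.ofFn A.prio).length +
    ((tableOf (fun q i => (A.δi q i : ℕ))).length + (x * nc + c))) by omega,
    getD_append_add, getD_append_add, getD_append_add, List.getD_append _ _ _ _ e2, getD_tableOf]

theorem getD_δc_snd (x : Fin nq) (c : Fin nc) :
    A.encode.getD (6 + nq + nq * ni + nq * nc + (x * nc + c)) 0 = (A.δc x c).2 := by
  obtain ⟨L, hL, -, h⟩ := A.encode_eq
  have e := List.length_ofFn (f := A.prio)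
  have e1 := length_tableOf (fun q i => (A.δi q i : ℕ))
  have e2 := length_tableOf (fun q c => ((A.δc q c).1 : ℕ))
  have e3 := lt_length_tableOf (fun q c => ((A.δc q c).2 : ℕ)) x c
  rw [h, show 6 + nq + nq * ni + nq * nc + (x * nc + c) = L.length + ((List.ofFn A.prio).length +
    ((tableOf (fun q i => (A.δi q i : ℕ))).length +
    ((tableOf (fun q c => ((A.δc q c).1 : ℕ))).length + (x * nc + c)))) by omega,
    getD_append_add, getD_append_add, getD_append_add, getD_append_add,
    List.getD_append _ _ _ _ e3, getD_tableOf]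

theorem getD_δr (x : Fin nq) (Z : Fin ng) (r : Fin nr) :
    A.encode.getD (6 + nq + nq * ni + nq * nc + nq * nc + ((x * ng + Z) * nr + r)) 0 =
      A.δr x Z r := by
  obtain ⟨L, hL, -, h⟩ := A.encode_eq
  have e := List.length_ofFn (f := A.prio)
  have e1 := length_tableOf (fun q i => (A.δi q i : ℕ))
  have e2 := length_tableOf (fun q c => ((A.δc q c).1 : ℕ))
  have e3 := length_tableOf (fun q c => ((A.δc q c).2 : ℕ))
  have e4 : (x : ℕ) * ng + Z = (finProdFinEquiv (x, Z) : Fin (nq * ng)) := by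
    rw [finProdFinEquiv_apply_val]; ring
  rw [h, show 6 + nq + nq * ni + nq * nc + nq * nc + ((x * ng + Z) * nr + r) =
    L.length + ((List.ofFn A.prio).length +
    ((tableOf (fun q i => (A.δi q i : ℕ))).length +
    ((tableOf (fun q c => ((A.δc q c).1 : ℕ))).length +
    ((tableOf (fun q c => ((A.δc q c).2 : ℕ))).length + ((x * ng + Z) * nr + r))))) by omega,
    getD_append_add, getD_append_add, getD_append_add, getD_append_add, getD_append_add, e4,
    getD_tableOf]
  simp

theorem length_le_inputSize (l : List ℕ) : l.length ≤ RAM.inputSize l := by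
  induction l with
  | nil => simp [RAM.inputSize]
  | cons a l ih => simp only [RAM.inputSize, List.map_cons, List.sum_cons, List.length_cons] at *; omega

end Encode

/-! ### Facts about an automaton as numbers -/

/-- The number with the digits `t`, `x`, `y`, `z` in base `M`. -/
def code (M t x y z : ℕ) : ℕ := ((t * M + x) * M + y) * M + z

theorem digit_inj {M a b a' b' : ℕ} (hb : b < M) (hb' : b' < M) (h : a * M + b = a' * M + b') :
    a = a' ∧ b = b' := by
  have h1 : b = b' := by
    have := congrArg (· % M) h
    simpa [Nat.mul_add_mod_self_right, Nat.mod_eq_of_lt hb, Nat.mod_eq_of_lt hb'] using this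
  subst h1
  exact ⟨Nat.eq_of_mul_eq_mul_right (by omega) (Nat.add_right_cancel h), rfl⟩

theorem code_inj {M t x y z t' x' y' z' : ℕ} (hx : x < M) (hy : y < M) (hz : z < M)
    (hx' : x' < M) (hy' : y' < M) (hz' : z' < M) (h : code M t x y z = code M t' x' y' z') :
    t = t' ∧ x = x' ∧ y = y' ∧ z = z' := by
  simp only [code] at h
  obtain ⟨h₁, rfl⟩ := digit_inj hz hz' h
  obtain ⟨h₂, rfl⟩ := digit_inj hy hy' h₁
  obtain ⟨rfl, rfl⟩ := digit_inj hx hx' h₂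
  exact ⟨rfl, rfl, rfl, rfl⟩

theorem code_lt {M t x y z : ℕ} (ht : t < M) (hx : x < M) (hy : y < M) (hz : z < M) :
    code M t x y z < M ^ 4 := by
  have step : ∀ {a b k : ℕ}, a < M ^ k → b < M → a * M + b < M ^ (k + 1) := by
    intro a b k ha hb
    calc a * M + b < (a + 1) * M := by rw [Nat.succ_mul]; omega
      _ ≤ M ^ k * M := Nat.mul_le_mul_right _ ha
      _ = M ^ (k + 1) := (pow_succ _ _).symm
  exact step (step (step (k := 1) (by simpa using ht) hx) hy) hz

variable (A : ParityDVPA (Fin nc) (Fin ni) (Fin nr) (Fin nq) (Fin ng))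

/-- The first argument is a tag, and unused places are zero. Connections are indexed by a state `v`
instead of the threshold `A.prio v`: priorities are written in binary and may be exponentially
large, but only the thresholds given by states matter. -/
def IsFact : ℕ → ℕ → ℕ → ℕ → Prop
  | 0, x, y, z => z = 0 ∧ ∃ hx hy, A.Summary false ⟨x, hx⟩ ⟨y, hy⟩
  | 1, x, y, z => z = 0 ∧ ∃ hx hy, A.Summary true ⟨x, hx⟩ ⟨y, hy⟩
  | 2, x, y, z => z = 0 ∧ ∃ hx hy, A.Edge ⟨x, hx⟩ ⟨y, hy⟩
  | 3, x, y, z => y = 0 ∧ z = 0 ∧ ∃ hx, A.Reach ⟨x, hx⟩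
  | 4, v, x, y => ∃ hv hx hy, A.Conn (A.prio ⟨v, hv⟩) ⟨x, hx⟩ ⟨y, hy⟩
  | 5, b, v, k => b < 2 ∧ ∃ hv, A.Rank b ⟨v, hv⟩ k
  | 6, b, k, z => z = 0 ∧ b < 2 ∧ A.Bound b k
  | _, _, _, _ => False

variable {A} in
theorem IsFact.lt {t x y z : ℕ} (h : A.IsFact t x y z) :
    t < nq + 10 ∧ x < nq + 10 ∧ y < nq + 10 ∧ z < nq + 10 := by
  have hq := A.start.2
  have hc : Nat.card (Fin nq) = nq := by simp
  unfold IsFact at h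
  split at h
  · obtain ⟨rfl, hx, hy, -⟩ := h; omega
  · obtain ⟨rfl, hx, hy, -⟩ := h; omega
  · obtain ⟨rfl, hx, hy, -⟩ := h; omega
  · obtain ⟨rfl, rfl, hx, -⟩ := h; omega
  · obtain ⟨hv, hx, hy, -⟩ := h; omega
  · obtain ⟨hb, hv, h⟩ := h
    have := h.le_card hb
    omega
  · obtain ⟨rfl, hb, h⟩ := h
    have := h.le_card hb
    omega
  · exact h.elim

/-- The set of the codes of all facts. -/
def factSet : Set ℕ := {a | ∃ t x y z, A.IsFact t x y z ∧ code (nq + 10) t x y z = a}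

variable {A} in
theorem mem_factSet {t x y z : ℕ} (hx : x < nq + 10) (hy : y < nq + 10) (hz : z < nq + 10) :
    code (nq + 10) t x y z ∈ A.factSet ↔ A.IsFact t x y z := by
  constructor
  · rintro ⟨t', x', y', z', h, he⟩
    obtain ⟨-, hx', hy', hz'⟩ := h.lt
    obtain ⟨rfl, rfl, rfl, rfl⟩ := code_inj hx' hy' hz' hx hy hz he
    exact h
  · exact fun h => ⟨t, x, y, z, h, rfl⟩

theorem factSet_subset : A.factSet ⊆ Set.Iio ((nq + 10) ^ 4) := by
  rintro _ ⟨t, x, y, z, h, rfl⟩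
  obtain ⟨ht, hx, hy, hz⟩ := h.lt
  exact code_lt ht hx hy hz

section

variable {A} {x y v : Fin nq} {b k : ℕ}

theorem mem_factSet_zero : code (nq + 10) 0 x y 0 ∈ A.factSet ↔ A.Summary false x y := by
  rw [mem_factSet (by omega) (by omega) (by omega)]; simp [IsFact]

theorem mem_factSet_one : code (nq + 10) 1 x y 0 ∈ A.factSet ↔ A.Summary true x y := by
  rw [mem_factSet (by omega) (by omega) (by omega)]; simp [IsFact]

theorem mem_factSet_two : code (nq + 10) 2 x y 0 ∈ A.factSet ↔ A.Edge x y := by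
  rw [mem_factSet (by omega) (by omega) (by omega)]; simp [IsFact]

theorem mem_factSet_three : code (nq + 10) 3 x 0 0 ∈ A.factSet ↔ A.Reach x := by
  rw [mem_factSet (by omega) (by omega) (by omega)]; simp [IsFact]

theorem mem_factSet_four : code (nq + 10) 4 v x y ∈ A.factSet ↔ A.Conn (A.prio v) x y := by
  rw [mem_factSet (by omega) (by omega) (by omega)]; simp [IsFact]

theorem mem_factSet_five (hb : b < 2) (hk : k < nq + 10) :
    code (nq + 10) 5 b v k ∈ A.factSet ↔ A.Rank b v k := by
  rw [mem_factSet (by omega) (by omega) (by omega)]; simp [IsFact, hb]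

theorem mem_factSet_six (hb : b < 2) (hk : k < nq + 10) :
    code (nq + 10) 6 b k 0 ∈ A.factSet ↔ A.Bound b k := by
  rw [mem_factSet (by omega) (by omega) (by omega)]; simp [IsFact, hb]

end

/-- Closure of a set of codes under the rules that define the facts. -/
structure FactClosed (X : Set ℕ) : Prop where
  refl : ∀ x : Fin nq, code (nq + 10) 1 x x 0 ∈ X
  intern : ∀ (x : Fin nq) (i : Fin ni), code (nq + 10) 0 x (A.δi x i) 0 ∈ X
  nest : ∀ (x : Fin nq) (c : Fin nc) (z : Fin nq) (r : Fin nr),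
    code (nq + 10) 1 (A.δc x c).1 z 0 ∈ X → code (nq + 10) 0 x (A.δr z (A.δc x c).2 r) 0 ∈ X
  snoc : ∀ x y z : Fin nq, code (nq + 10) 1 x y 0 ∈ X → code (nq + 10) 0 y z 0 ∈ X →
    code (nq + 10) 1 x z 0 ∈ X
  edge : ∀ x y : Fin nq, code (nq + 10) 0 x y 0 ∈ X → code (nq + 10) 2 x y 0 ∈ X
  edge_call : ∀ (x : Fin nq) (c : Fin nc), code (nq + 10) 2 x (A.δc x c).1 0 ∈ X
  start : code (nq + 10) 3 A.start 0 0 ∈ X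
  reach : ∀ x y : Fin nq, code (nq + 10) 3 x 0 0 ∈ X → code (nq + 10) 2 x y 0 ∈ X →
    code (nq + 10) 3 y 0 0 ∈ X
  conn : ∀ v x y : Fin nq, code (nq + 10) 2 x y 0 ∈ X → A.prio x ≤ A.prio v →
    A.prio y ≤ A.prio v → code (nq + 10) 4 v x y ∈ X
  conn_trans : ∀ v x y z : Fin nq, code (nq + 10) 4 v x y ∈ X → code (nq + 10) 4 v y z ∈ X →
    code (nq + 10) 4 v x z ∈ X
  base : ∀ (v : Fin nq) (b : Fin 2), code (nq + 10) 3 v 0 0 ∈ X → code (nq + 10) 4 v v v ∈ X →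
    code (nq + 10) 5 b v (1 + (A.prio v % 2 - b) + (b - A.prio v % 2)) ∈ X
  step : ∀ (u v : Fin nq) (b : Fin 2) (k : Fin (nq + 3)), code (nq + 10) 5 b u k ∈ X →
    code (nq + 10) 4 v u v ∈ X → code (nq + 10) 4 v v u ∈ X → A.prio u < A.prio v →
    A.prio u % 2 ≠ A.prio v % 2 → code (nq + 10) 5 b v (k + 1) ∈ X
  bound_one : ∀ b : Fin 2, code (nq + 10) 6 b 1 0 ∈ X
  bound : ∀ (b : Fin 2) (v : Fin nq) (k : Fin (nq + 3)), code (nq + 10) 5 b v k ∈ X →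
    code (nq + 10) 6 b k 0 ∈ X

/-- Soundness of the rules: saturation never leaves the set of true facts. -/
theorem factClosed_factSet : A.FactClosed A.factSet where
  refl x := mem_factSet_one.mpr (.refl x)
  intern x i := mem_factSet_zero.mpr (.intern x i)
  nest x c z r h := mem_factSet_zero.mpr (.nest x c z r (mem_factSet_one.mp h))
  snoc x y z h h' := mem_factSet_one.mpr ((mem_factSet_one.mp h).snoc (mem_factSet_zero.mp h'))
  edge x y h := mem_factSet_two.mpr (.inl (mem_factSet_zero.mp h))
  edge_call x c := mem_factSet_two.mpr (.inr ⟨c, rfl⟩)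
  start := mem_factSet_three.mpr .refl
  reach x y h h' := mem_factSet_three.mpr ((mem_factSet_three.mp h).tail (mem_factSet_two.mp h'))
  conn v x y h hx hy := mem_factSet_four.mpr (.single ⟨mem_factSet_two.mp h, hx, hy⟩)
  conn_trans v x y z h h' := mem_factSet_four.mpr
    (Relation.TransGen.trans (mem_factSet_four.mp h) (mem_factSet_four.mp h'))
  base v b h h' := (mem_factSet_five b.2 (by omega)).mpr
    (.base v (mem_factSet_three.mp h) (mem_factSet_four.mp h'))
  step u v b k h h₁ h₂ hp hp' := (mem_factSet_five b.2 (by omega)).mpr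
    (.step u v k ((mem_factSet_five b.2 (by omega)).mp h)
      ⟨hp, hp', mem_factSet_four.mp h₁, mem_factSet_four.mp h₂⟩)
  bound_one b := (mem_factSet_six b.2 (by omega)).mpr (.inl rfl)
  bound b v k h := (mem_factSet_six b.2 (by omega)).mpr
    (.inr ⟨v, (mem_factSet_five b.2 (by omega)).mp h⟩)

variable {A}

/-! ### Completeness: every fact lies in each closed set. -/

theorem Summary.mem {X : Set ℕ} (hX : A.FactClosed X) {o : Bool} {x y : Fin nq}
    (h : A.Summary o x y) : code (nq + 10) o.toNat x y 0 ∈ X := by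
  induction h with
  | refl x => exact hX.refl x
  | snoc _ _ ih₁ ih₂ => exact hX.snoc _ _ _ ih₁ ih₂
  | intern x i => exact hX.intern x i
  | nest x c z r _ ih => exact hX.nest x c z r ih

theorem Edge.mem {X : Set ℕ} (hX : A.FactClosed X) {x y : Fin nq} (h : A.Edge x y) :
    code (nq + 10) 2 x y 0 ∈ X := by
  rcases h with h | ⟨c, rfl⟩
  exacts [hX.edge _ _ (h.mem hX), hX.edge_call x c]

theorem Reach.mem {X : Set ℕ} (hX : A.FactClosed X) {x : Fin nq} (h : A.Reach x) :
    code (nq + 10) 3 x 0 0 ∈ X := by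
  induction h with
  | refl => exact hX.start
  | tail _ h ih => exact hX.reach _ _ ih (h.mem hX)

theorem Conn.mem {X : Set ℕ} (hX : A.FactClosed X) {v x y : Fin nq} (h : A.Conn (A.prio v) x y) :
    code (nq + 10) 4 v x y ∈ X := by
  induction h with
  | single h => exact hX.conn _ _ _ (h.1.mem hX) h.2.1 h.2.2
  | tail _ h ih => exact hX.conn_trans _ _ _ _ ih (hX.conn _ _ _ (h.1.mem hX) h.2.1 h.2.2)

theorem Rank.mem {X : Set ℕ} (hX : A.FactClosed X) {b : ℕ} (hb : b < 2) {v : Fin nq} {k : ℕ}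
    (h : A.Rank b v k) : code (nq + 10) 5 b v k ∈ X := by
  induction h with
  | base v h h' => exact hX.base v ⟨b, hb⟩ (h.mem hX) (h'.mem hX)
  | step u v k h hp ih =>
    have := h.le_card hb
    rw [Nat.card_fin] at this
    exact hX.step u v ⟨b, hb⟩ ⟨k, by omega⟩ ih (hp.2.2.1.mem hX) (hp.2.2.2.mem hX) hp.1 hp.2.1

theorem Bound.mem {X : Set ℕ} (hX : A.FactClosed X) {b : ℕ} (hb : b < 2) {k : ℕ}
    (h : A.Bound b k) : code (nq + 10) 6 b k 0 ∈ X := by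
  rcases h with rfl | ⟨v, h⟩
  · exact hX.bound_one ⟨b, hb⟩
  · have := h.le_card hb
    rw [Nat.card_fin] at this
    exact hX.bound ⟨b, hb⟩ v ⟨k, by omega⟩ (h.mem hX hb)

end ParityDVPA

/-! ### The algorithm -/

namespace RAM

open RAM.Expr RAM.Test ParityDVPA

/-- The code of a fact. -/
def codeExpr (t : ℕ) (x y z : Expr) : Expr :=
  add (mul (add (mul (add (mul (const t) 3) x) 3) y) 3) z

def prioExpr (x : Expr) : Expr := inp (add (const 6) x)

/-- Variable `9` holds `2`, so this is the remainder modulo `2`. -/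
def parityExpr (x : Expr) : Expr := sub (prioExpr x) (mul (half (prioExpr x)) 9)

def distExpr (a b : Expr) : Expr := add (sub a b) (sub b a)

/-- The offsets skip the six header entries, the priorities and the preceding tables. Variables `4`
to `8` hold the numbers of states, internals, calls, returns and stack symbols, the last two
adjusted as in `Loaded`. -/
def offsetIntern : Expr := add (const 6) (var 4)

def offsetCall : Expr := add offsetIntern (mul (var 4) 5)

def offsetPush : Expr := add offsetCall (mul (var 4) 6)

def offsetRet : Expr := add offsetPush (mul (var 4) 6)

def lengthExpr : Expr := add offsetRet (mul (mul (var 4) 8) 7)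

def internExpr (x i : Expr) : Expr := inp (add offsetIntern (add (mul x 5) i))

def callExpr (x c : Expr) : Expr := inp (add offsetCall (add (mul x 6) c))

def pushExpr (x c : Expr) : Expr := inp (add offsetPush (add (mul x 6) c))

def retExpr (x Z r : Expr) : Expr := inp (add offsetRet (add (mul (add (mul x 8) Z) 7) r))

def leTest (x y : Expr) : Test := val (sub (add (const 1) (prioExpr y)) (prioExpr x))

/-- The rules that define the facts. -/
def factRules : List Clause :=
  [⟨[(11, 4)], [], codeExpr 1 (var 11) (var 11) (const 0)⟩,
   ⟨[(11, 4), (12, 5)], [], codeExpr 0 (var 11) (internExpr (var 11) (var 12)) (const 0)⟩,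
   ⟨[(11, 4), (12, 6), (13, 4), (14, 7)],
     [fact (codeExpr 1 (callExpr (var 11) (var 12)) (var 13) (const 0))],
     codeExpr 0 (var 11) (retExpr (var 13) (pushExpr (var 11) (var 12)) (var 14)) (const 0)⟩,
   ⟨[(11, 4), (12, 4), (13, 4)], [fact (codeExpr 1 (var 11) (var 12) (const 0)),
     fact (codeExpr 0 (var 12) (var 13) (const 0))], codeExpr 1 (var 11) (var 13) (const 0)⟩,
   ⟨[(11, 4), (12, 4)], [fact (codeExpr 0 (var 11) (var 12) (const 0))],
     codeExpr 2 (var 11) (var 12) (const 0)⟩,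
   ⟨[(11, 4), (12, 6)], [], codeExpr 2 (var 11) (callExpr (var 11) (var 12)) (const 0)⟩,
   ⟨[], [], codeExpr 3 (inp (const 5)) (const 0) (const 0)⟩,
   ⟨[(11, 4), (12, 4)], [fact (codeExpr 3 (var 11) (const 0) (const 0)),
     fact (codeExpr 2 (var 11) (var 12) (const 0))], codeExpr 3 (var 12) (const 0) (const 0)⟩,
   ⟨[(11, 4), (12, 4), (13, 4)], [fact (codeExpr 2 (var 12) (var 13) (const 0)),
     leTest (var 12) (var 11), leTest (var 13) (var 11)], codeExpr 4 (var 11) (var 12) (var 13)⟩,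
   ⟨[(11, 4), (12, 4), (13, 4), (14, 4)], [fact (codeExpr 4 (var 11) (var 12) (var 13)),
     fact (codeExpr 4 (var 11) (var 13) (var 14))], codeExpr 4 (var 11) (var 12) (var 14)⟩,
   ⟨[(11, 4), (12, 9)], [fact (codeExpr 3 (var 11) (const 0) (const 0)),
     fact (codeExpr 4 (var 11) (var 11) (var 11))],
     codeExpr 5 (var 12) (var 11) (add (add (const 1) (sub (parityExpr (var 11)) (var 12)))
       (sub (var 12) (parityExpr (var 11))))⟩,
   ⟨[(11, 4), (12, 4), (13, 9), (14, 10)], [fact (codeExpr 5 (var 13) (var 11) (var 14)),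
     fact (codeExpr 4 (var 12) (var 11) (var 12)), fact (codeExpr 4 (var 12) (var 12) (var 11)),
     val (sub (prioExpr (var 12)) (prioExpr (var 11))),
     val (distExpr (parityExpr (var 11)) (parityExpr (var 12)))],
     codeExpr 5 (var 13) (var 12) (add (var 14) (const 1))⟩,
   ⟨[(11, 9)], [], codeExpr 6 (var 11) (const 1) (const 0)⟩,
   ⟨[(11, 9), (12, 4), (13, 10)], [fact (codeExpr 5 (var 11) (var 12) (var 13))],
     codeExpr 6 (var 11) (var 13) (const 0)⟩]

theorem factRules_wf : ∀ r ∈ factRules, r.WF := by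
  simp only [factRules, Clause.WF]
  decide

/-- The variables hold the parameters of an automaton, and `l` is its description. -/
structure Loaded {nc ni nr nq ng : ℕ} (A : ParityDVPA (Fin nc) (Fin ni) (Fin nr) (Fin nq) (Fin ng))
    (l : ℕ → ℕ) (ρ : Fin 20 → ℕ) : Prop where
  input : ∀ a, l a = A.encode.getD a 0
  base : ρ 3 = nq + 10
  states : ρ 4 = nq
  interns : ρ 5 = ni
  calls : ρ 6 = nc
  rets : ρ 7 = nr * (1 - (1 - ng))
  stack : ρ 8 = ng * (1 - (1 - nr))
  two : ρ 9 = 2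
  ranks : ρ 10 = nq + 3

theorem forall_lt_iff {n : ℕ} {P : ℕ → Prop} : (∀ i < n, P i) ↔ ∀ x : Fin n, P x :=
  ⟨fun h x => h x x.2, fun h i hi => h ⟨i, hi⟩⟩

/-- Once the expressions are evaluated in a loaded state, the clauses match the fields of
`FactClosed` in order. Only the clause for returns needs an argument, because of the adjusted sizes.
-/
theorem closed_factRules_iff {nc ni nr nq ng : ℕ}
    {A : ParityDVPA (Fin nc) (Fin ni) (Fin nr) (Fin nq) (Fin ng)} {l : ℕ → ℕ} {ρ : Fin 20 → ℕ}
    (h : Loaded A l ρ) {X : Set ℕ} :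
    (∀ y, (∃ r ∈ factRules, r.clauses l ρ X y) → y ∈ X) ↔ A.FactClosed X := by
  have hstart : A.encode.getD 5 0 = A.start := rfl
  have hpar : ∀ n, n - n / 2 * 2 = n % 2 := fun n => by omega
  have hle : ∀ a b : ℕ, 1 + a - b ≠ 0 ↔ b ≤ a := fun a b => by omega
  have hlt : ∀ a b : ℕ, a - b ≠ 0 ↔ b < a := fun a b => by omega
  have hne : ∀ a b : ℕ, a - b + (b - a) ≠ 0 ↔ a ≠ b := fun a b => by omega
  have hret : (∀ (x : Fin nq) (c : Fin nc) (z : Fin nq) (r : Fin (nr * (1 - (1 - ng)))),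
      code (nq + 10) 1 (A.δc x c).1 z 0 ∈ X → code (nq + 10) 0 x (A.encode.getD (6 + nq + nq * ni +
        nq * nc + nq * nc + ((z * (ng * (1 - (1 - nr))) + (A.δc x c).2) *
        (nr * (1 - (1 - ng))) + r)) 0) 0 ∈ X) ↔
      ∀ (x : Fin nq) (c : Fin nc) (z : Fin nq) (r : Fin nr),
      code (nq + 10) 1 (A.δc x c).1 z 0 ∈ X →
      code (nq + 10) 0 x (A.δr z (A.δc x c).2 r) 0 ∈ X := by
    refine forall_congr' fun x => forall_congr' fun c => forall_congr' fun z => ?_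
    -- A call transition supplies a stack symbol, and below a return supplies `0 < nr`; so both
    -- correction factors are `1` whenever the clause has an instance.
    have hg : 1 - (1 - ng) = 1 := by have := (A.δc x c).2.2; omega
    rw [← forall_lt_iff (P := fun r => code (nq + 10) 1 (A.δc x c).1 z 0 ∈ X →
      code (nq + 10) 0 x (A.encode.getD (6 + nq + nq * ni +
        nq * nc + nq * nc + ((z * (ng * (1 - (1 - nr))) + (A.δc x c).2) *
        (nr * (1 - (1 - ng))) + r)) 0) 0 ∈ X), hg, mul_one, forall_lt_iff]
    refine forall_congr' fun r => ?_
    rw [show 1 - (1 - nr) = 1 by have := r.2; omega, mul_one, getD_δr]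
  simp only [factRules, List.mem_cons, List.not_mem_nil, or_false, exists_eq_or_imp,
    exists_eq_left, or_imp, forall_and, Clause.clauses, Clauses.inst, Clause.ground,
    codeExpr, callExpr, pushExpr, retExpr, internExpr, prioExpr, parityExpr, distExpr, leTest,
    offsetIntern, offsetCall, offsetPush, offsetRet, Test.holds_val, Test.holds_fact, forall_eq,
    Expr.eval, Function.update_apply, Fin.reduceEq, if_true, if_false, h.base, h.states,
    h.interns, h.calls, h.rets, h.stack, h.two, h.ranks, h.input, forall_exists_index, and_imp,
    forall_eq', forall_lt_iff, hstart, hpar, hle, hlt, hne, getD_prio, getD_δi, getD_δc_fst,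
    getD_δc_snd, forall_const, IsEmpty.forall_iff]
  constructor
  · rintro ⟨h1, h2, h3, h4, h5, h6, h7, h8, h9, h10, h11, h12, h13, h14⟩
    exact
      { refl := fun x => h1 _ x rfl
        intern := fun x i => h2 _ x i rfl
        nest := hret.mp fun x c z r h => h3 _ x c z r h rfl
        snoc := fun x y z h h' => h4 _ x y z h h' rfl
        edge := fun x y h => h5 _ x y h rfl
        edge_call := fun x c => h6 _ x c rfl
        start := h7
        reach := fun x y h h' => h8 _ x y h h' rfl
        conn := fun v x y h hx hy => h9 _ v x y h hx hy rfl
        conn_trans := fun v x y z h h' => h10 _ v x y z h h' rfl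
        base := fun v b h h' => h11 _ v b h h' rfl
        step := fun u v b k h h₁ h₂ hp hp' => h12 _ u v b k h h₁ h₂ hp hp' rfl
        bound_one := fun b => h13 _ b rfl
        bound := fun b v k h => h14 _ b v k h rfl }
  · intro hX
    refine ⟨?_, ?_, ?_, ?_, ?_, ?_, hX.start, ?_, ?_, ?_, ?_, ?_, ?_, ?_⟩
    · rintro _ x rfl; exact hX.refl x
    · rintro _ x i rfl; exact hX.intern x i
    · rintro _ x c z r h rfl; exact hret.mpr hX.nest x c z r h
    · rintro _ x y z h h' rfl; exact hX.snoc x y z h h'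
    · rintro _ x y h rfl; exact hX.edge x y h
    · rintro _ x c rfl; exact hX.edge_call x c
    · rintro _ x y h h' rfl; exact hX.reach x y h h'
    · rintro _ v x y h hx hy rfl; exact hX.conn v x y h hx hy
    · rintro _ v x y z h h' rfl; exact hX.conn_trans v x y z h h'
    · rintro _ v b h h' rfl; exact hX.base v b h h'
    · rintro _ u v b k h h₁ h₂ hp hp' rfl; exact hX.step u v b k h h₁ h₂ hp hp'
    · rintro _ b rfl; exact hX.bound_one b
    · rintro _ b v k h rfl; exact hX.bound b v k h

end RAM

namespace RAM

open RAM.Expr RAM.Test ParityDVPA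

theorem Loaded.saturated {nc ni nr nq ng : ℕ}
    {A : ParityDVPA (Fin nc) (Fin ni) (Fin nr) (Fin nq) (Fin ng)} {l : ℕ → ℕ} {ρ : Fin 20 → ℕ}
    (h : Loaded A l ρ) {X : Set ℕ} {m : ℕ} (hm : (nq + 10) ^ 4 < m)
    (hX : Passes (fun X y => ∃ r ∈ factRules, r.clauses l ρ X y) m X) {b k : ℕ} (hb : b < 2)
    (hk : k < nq + 10) : code (nq + 10) 6 b k 0 ∈ X ↔ A.Bound b k := by
  have hA := (closed_factRules_iff h).mpr A.factClosed_factSet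
  have hfin : A.factSet.Finite := (Set.finite_Iio _).subset A.factSet_subset
  have hcard : A.factSet.ncard ≤ (nq + 10) ^ 4 :=
    (Set.ncard_le_ncard A.factSet_subset (Set.finite_Iio _)).trans (by simp [Set.ncard_eq_toFinset_card'])
  constructor
  · exact fun hmem => (mem_factSet_six hb hk).mp (hX.least hA hmem)
  · exact fun hB => hB.mem ((closed_factRules_iff h).mp
      (hX.closed hA hfin (hcard.trans_lt hm))) hb

/-- Assignments that load the parameters from the header of the input. The number of returns is
replaced by zero if there are no stack symbols, and vice versa. -/
def loadParams : List (Fin 20 × Expr) :=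
  [(4, inp (const 3)), (5, inp (const 1)), (6, inp (const 0)),
   (9, sub (const 1) (sub (const 1) (inp (const 2)))),
   (10, sub (const 1) (sub (const 1) (inp (const 4)))),
   (8, mul (inp (const 4)) 9), (7, mul (inp (const 2)) 10),
   (3, add (var 4) (const 10)),
   (2, add (mul (mul (mul (var 3) 3) 3) 3) (const 1)),
   (9, const 2), (10, add (var 4) (const 3))]

def loadProg : Prog :=
  .seq (assign 1 (const 6)) (.seq (assigns loadParams) (assign 1 lengthExpr))

/-- The program that computes the stair parity index. -/
def indexProg : Prog :=
  .seq loadProg (.seq (saturate 2 (passProg factRules)) (countProg 11 10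
    [fact (codeExpr 6 (const 0) (var 11) (const 0)),
      fact (codeExpr 6 (const 1) (var 11) (const 0))]))

/-- The length of the input is not given, so register `1` is first set to `6`, which makes just the
header readable. The true length is then computed from the sizes. `N` dominates all variables,
including the number of passes. -/
theorem exists_runs_load : ∃ p : Polynomial ℕ, ∀ (nc ni nr nq ng : ℕ)
    (A : ParityDVPA (Fin nc) (Fin ni) (Fin nr) (Fin nq) (Fin ng)),
    ∃ (N : ℕ) (s : State) (l : ℕ → ℕ) (ρ : Fin 20 → ℕ), N = (inputSize A.encode + 11) ^ 4 ∧
      Runs loadProg (p.eval N) (inputState A.encode) s ∧ Rep s l ρ N ∅ ∧ Loaded A l ρ ∧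
      ρ 2 = (nq + 10) ^ 4 + 1 ∧ ∀ x, 11 ≤ x → ρ x = 0 := by
  obtain ⟨p₁, hp₁⟩ := exists_runs_assign 1 (const 6)
  obtain ⟨p₂, hp₂⟩ := exists_runs_assigns loadParams
  obtain ⟨p₃, hp₃⟩ := exists_runs_assign 1 lengthExpr
  refine ⟨p₁ + (p₂ + p₃), fun nc ni nr nq ng A => ?_⟩
  have hlen : 6 + nq + nq * ni + nq * nc + nq * nc + nq * ng * nr ≤ inputSize A.encode :=
    A.length_encode ▸ length_le_inputSize _
  have hq : 0 < nq := A.start.pos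
  have hni : ni ≤ nq * ni := Nat.le_mul_of_pos_left _ hq
  have hnc : nc ≤ nq * nc := Nat.le_mul_of_pos_left _ hq
  -- Without stack symbols the table of returns is empty, so `nr` contributes only its binary length
  -- to the input and may be exponential in its size. Replacing it by zero keeps the loops
  -- polynomial; the same holds for `ng` without returns.
  have hnr : nr * (1 - (1 - ng)) ≤ nq * ng * nr := by
    rcases Nat.eq_zero_or_pos ng with rfl | hg
    · simp
    · rw [show 1 - (1 - ng) = 1 by omega, mul_one]
      exact Nat.le_mul_of_pos_left _ (Nat.mul_pos hq hg)
  have hng : ng * (1 - (1 - nr)) ≤ nq * ng * nr := by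
    rcases Nat.eq_zero_or_pos nr with rfl | hr
    · simp
    · rw [show 1 - (1 - nr) = 1 by omega, mul_one]
      exact (Nat.le_mul_of_pos_left _ hq).trans (Nat.le_mul_of_pos_right _ hr)
  have hbase : nq * (ng * (1 - (1 - nr))) * (nr * (1 - (1 - ng))) = nq * ng * nr := by
    rcases Nat.eq_zero_or_pos nr with rfl | hr
    · simp
    rcases Nat.eq_zero_or_pos ng with rfl | hg
    · simp
    rw [show 1 - (1 - nr) = 1 by omega, show 1 - (1 - ng) = 1 by omega, mul_one, mul_one]
  generalize hS : inputSize A.encode = S at *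
  have hN : S + 11 ≤ (S + 11) ^ 4 := Nat.le_self_pow (by norm_num) _
  have hM : (nq + 10) * (nq + 10) * (nq + 10) * (nq + 10) + 1 ≤ (S + 11) ^ 4 := by
    have : (nq + 10) ^ 4 < (S + 11) ^ 4 := Nat.pow_lt_pow_left (by omega) (by norm_num)
    rw [show (nq + 10) * (nq + 10) * (nq + 10) * (nq + 10) = (nq + 10) ^ 4 by ring]
    omega
  generalize hNN : (S + 11) ^ 4 = N at *
  -- The input as visible while the length is provisionally `6`.
  let l₀ : ℕ → ℕ := fun a => if a < 6 then A.encode.getD a 0 else 0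
  have e₀ : Env (inputState A.encode) (fun _ => 0) (fun _ => 0) N :=
    ⟨fun i => rfl, fun i => Nat.zero_le _, fun a ha => absurd ha (Nat.not_lt_zero a), fun a _ => rfl⟩
  obtain ⟨s₁, r₁, m₁, g₁⟩ := hp₁ _ _ _ N e₀
  have e₁ : Env s₁ l₀ (Function.update (fun _ => 0) 1 6) N := by
    refine ⟨g₁, fun i => ?_, fun a ha => ?_, fun a ha => ?_⟩
    · rw [Function.update_apply]; split_ifs <;> omega
    · rw [Function.update_self] at ha
      rw [m₁]
      exact (if_pos ha).symm
    · rw [Function.update_self] at ha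
      exact if_neg (by omega)
  have i0 : l₀ 0 = nc := rfl
  have i1 : l₀ 1 = ni := rfl
  have i2 : l₀ 2 = nr := rfl
  have i3 : l₀ 3 = nq := rfl
  have i4 : l₀ 4 = ng := rfl
  obtain ⟨s₂, r₂, m₂, e₂⟩ := hp₂ s₁ l₀ _ N e₁ (by
    simp only [loadParams, AssignsLe, Expr.eval, Function.update_apply, Fin.reduceEq, if_true,
      if_false, i0, i1, i2, i3, i4, ne_eq, not_false_eq_true, true_and, and_true]
    refine ⟨?_, ?_, ?_, ?_, ?_, ?_, ?_, ?_, ?_, ?_, ?_⟩ <;> omega)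
  generalize hρ₂ : assignsEnv l₀ loadParams _ = ρ₂ at e₂
  simp only [loadParams, assignsEnv, Expr.eval, Function.update_apply, Fin.reduceEq, if_true,
      if_false, i0, i1, i2, i3, i4] at hρ₂
  obtain ⟨s₃, r₃, m₃, g₃⟩ := hp₃ s₂ l₀ _ N e₂
  have v4 : ρ₂ 4 = nq := by rw [← hρ₂]; simp
  have v5 : ρ₂ 5 = ni := by rw [← hρ₂]; simp
  have v6 : ρ₂ 6 = nc := by rw [← hρ₂]; simp
  have v7 : ρ₂ 7 = nr * (1 - (1 - ng)) := by rw [← hρ₂]; simp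
  have v8 : ρ₂ 8 = ng * (1 - (1 - nr)) := by rw [← hρ₂]; simp
  have v3 : ρ₂ 3 = nq + 10 := by rw [← hρ₂]; simp
  have v2 : ρ₂ 2 = (nq + 10) ^ 4 + 1 := by rw [← hρ₂]; simp; ring
  have v9 : ρ₂ 9 = 2 := by rw [← hρ₂]; simp
  have v10 : ρ₂ 10 = nq + 3 := by rw [← hρ₂]; simp
  have v11 : ∀ x, 11 ≤ x → ρ₂ x = 0 := by
    intro x hx
    rw [← hρ₂]
    fin_cases x <;> first | rfl | exact absurd hx (by decide)
  have hl : lengthExpr.eval l₀ ρ₂ = A.encode.length := by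
    simp only [lengthExpr, offsetIntern, offsetCall, offsetPush, offsetRet, Expr.eval, v4, v5, v6,
      v7, v8, hbase, length_encode]
  rw [hl] at g₃
  have hmem : s₃.mem = (inputState A.encode).mem := m₃.trans (m₂.trans m₁)
  have hne : ∀ x : Fin 20, x ≠ 1 → Function.update ρ₂ 1 A.encode.length x = ρ₂ x :=
    fun x hx => Function.update_of_ne hx _ _
  refine ⟨N, s₃, fun a => A.encode.getD a 0, Function.update ρ₂ 1 A.encode.length, rfl,
    (r₁.seq (r₂.seq r₃)).mono (by simp), ⟨⟨g₃, fun i => ?_, fun a ha => by rw [hmem]; rfl,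
      fun a ha => ?_⟩, fun a => ?_⟩, ⟨fun a => rfl, ?_, ?_, ?_, ?_, ?_, ?_, ?_, ?_⟩, ?_, ?_⟩
  · rw [Function.update_apply]
    split_ifs
    · rw [length_encode]; omega
    · exact e₂.le i
  · rw [Function.update_self] at ha
    exact List.getD_eq_default _ _ ha
  · rw [hmem, Function.update_self]
    have : (inputState A.encode).mem (A.encode.length + a) = 0 :=
      List.getD_eq_default _ _ (by omega)
    simp [this]
  · rw [hne _ (by decide), v3]
  · rw [hne _ (by decide), v4]
  · rw [hne _ (by decide), v5]
  · rw [hne _ (by decide), v6]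
  · rw [hne _ (by decide), v7]
  · rw [hne _ (by decide), v8]
  · rw [hne _ (by decide), v9]
  · rw [hne _ (by decide), v10]
  · rw [hne _ (by decide), v2]
  · intro x hx
    rw [hne _ (by rintro rfl; exact absurd hx (by decide)), v11 x hx]

end RAM

/-- The stair parity index problem for stair parity DVPAs can be solved in polynomial time. -/
theorem mainTheorem4 :
    ∃ (P : RAM.Prog) (p : Polynomial ℕ),
      ∀ (nc ni nr nq ng : ℕ) (A : ParityDVPA (Fin nc) (Fin ni) (Fin nr) (Fin nq) (Fin ng)),
        ∃ k : ℕ, A.IsStairParityIndex k ∧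
          RAM.OutputsWithin P A.encode (p.eval (RAM.inputSize A.encode)) k := by
  classical
  obtain ⟨p₁, hp₁⟩ := RAM.exists_runs_load
  obtain ⟨p₂, hp₂⟩ := (RAM.applies_passProg RAM.factRules RAM.factRules_wf).saturate 2
  obtain ⟨p₃, hp₃⟩ := RAM.exists_runs_countProg 11 10 (by decide)
    [.fact (RAM.codeExpr 6 (.const 0) (.var 11) (.const 0)),
      .fact (RAM.codeExpr 6 (.const 1) (.var 11) (.const 0))]
  refine ⟨RAM.indexProg, (p₁ + (p₂ + p₃)).comp ((Polynomial.X + 11) ^ 4), fun nc ni nr nq ng A => ?_⟩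
  obtain ⟨N, s₁, l, ρ, hN, r₁, h₁, hl, hK, hz⟩ := hp₁ nc ni nr nq ng A
  obtain ⟨s₂, X, r₂, h₂, hX⟩ := hp₂ s₁ l ρ N hz h₁
  obtain ⟨s₃, r₃, h₃⟩ := hp₃ s₂ l ρ N X (hz 11 le_rfl) h₂
  -- The range `nq + 3` is the value of variable `10`, the bound of the counting loop.
  refine ⟨_, A.isStairParityIndex_card (n := nq + 3) (by simp), ?_⟩
  obtain ⟨t, ht, e⟩ := r₁.seq (r₂.seq r₃)
  refine ⟨t, s₃, ?_, e, ?_⟩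
  · simpa [hN] using ht
  · rw [h₃, hl.ranks]
    congr 1
    refine Finset.filter_congr fun n hn => ?_
    rw [Finset.mem_range] at hn
    rw [← hl.saturated (by omega) hX (b := 0) (by norm_num) (by omega),
      ← hl.saturated (by omega) hX (b := 1) (by norm_num) (by omega)]
    simp [RAM.codeExpr, hl.base, ParityDVPA.code]
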